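/- Write $\lg=\log_2$. A vector $\alpha=(\alpha_1,\ldots,\alpha_r)$ of elements of a finite abelian group $G$ (written multiplicatively) is a basis of $G$ if it generates $G$ and every $\beta\in G$ can be written uniquely as $\beta=\alpha_1^{x_1}\cdots\alpha_r^{x_r}$ with integers $0\le x_i<|\alpha_i|$, where $|\alpha_i|$ is the order of $\alpha_i$; the vector $x=(x_1,\ldots,x_r)$ is the discrete logarithm $\mathrm{DL}(\alpha,\beta)$. A generic algorithm accesses $G$ only through a black box: each group element is represented by a unique, arbitrarily assigned identifier, and the algorithm can ask for the product of two elements, or the inverse of one element, that it has already received; each such request counts as one group operation. It is given the prime $p$, the integers $n_i$ below, and the identifiers of the identity, of $\alpha_1,\ldots,\alpha_r$ and of $\beta$. There are a deterministic generic algorithm and an absolute constant $c$ such that the following holds. Let $p$ be a prime, let $G$ be a finite abelian $p$-group of rank $r$ (its minimal number of generators) and exponent $p^m$, and let $\alpha=(\alpha_1,\ldots,\alpha_r)$ be a basis of $G$. Let $n_i=\log_p|\alpha_i|$, and for $0\le j<m$ let $r_j$ be the rank of the subgroup $G^{p^j}=\{g^{p^j}: g\in G\}$. Then for every $\beta\in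 G$ the algorithm computes $\mathrm{DL}(\alpha,\beta)$ using at most $$c\left(\sum_{i=1}^r\frac{\lg(n_i+1)}{\lg\lg(n_i+2)}\,\lg|\alpha_i|+\sum_{j=0}^{m-1}p^{r_j/2}\right)$$ group operations. -/

import Mathlib

namespace GenericDL

/-! ### Bases and discrete logarithms -/

section Basis

variable {G : Type*} [CommGroup G] {r : ℕ}

/-- `x = DL(α, β)`: the discrete logarithm of `β` with respect to `α`, i.e. the exponent vector
with `0 ≤ x i < |α i|` and `α 1 ^ x 1 * ... * α r ^ x r = β`. -/
def IsDL (α : Fin r → G) (β : G) (x : Fin r → ℕ) : Prop :=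
  (∀ i, x i < orderOf (α i)) ∧ ∏ i, α i ^ x i = β

/-- `α` is a basis of `G`: it generates `G`, and every element has exactly one discrete logarithm
with respect to `α`. -/
def IsBasis (α : Fin r → G) : Prop :=
  Subgroup.closure (Set.range α) = ⊤ ∧ ∀ β : G, ∃! x : Fin r → ℕ, IsDL α β x

end Basis

/-- The subgroup of `k`-th powers of a commutative group. -/
def powSubgroup (G : Type*) [CommGroup G] (k : ℕ) : Subgroup G :=
  (powMonoidHom k : G →* G).range

/-- Binary logarithm. -/
noncomputable def lg (x : ℝ) : ℝ := Real.logb 2 x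

/-! ### Generic algorithms

Group elements live inside a black box. The algorithm addresses those it has received so far by
their position in a list, and of each of them it sees only an identifier, which is a natural
number. Identifiers are assigned to the group elements by an arbitrary injective function. -/

/-- What a generic algorithm may do next: ask the black box for the product of the elements at
positions `a` and `b`, ask it for the inverse of the element at position `a`, or halt with an
output. -/
inductive Instr where
  | mul (a b : ℕ)
  | inv (a : ℕ)
  | halt (out : List ℕ)

/-- The instructions as a sum type; this provides the standard encoding by natural numbers. -/
def Instr.equivSum : Instr ≃ (ℕ × ℕ) ⊕ (ℕ ⊕ List ℕ) where
  toFun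
    | .mul a b => .inl (a, b)
    | .inv a => .inr (.inl a)
    | .halt out => .inr (.inr out)
  invFun
    | .inl (a, b) => .mul a b
    | .inr (.inl a) => .inv a
    | .inr (.inr out) => .halt out
  left_inv := by rintro (_ | _ | _) <;> rfl
  right_inv := by rintro (_ | _ | _) <;> rfl

instance : Primcodable Instr := Primcodable.ofEquiv _ Instr.equivSum

/-- A deterministic generic algorithm: a computable function that determines the next instruction
from the integer input (a number and a list of numbers) and from the list of the identifiers of
all group elements received so far. -/
structure GenericAlgorithm where
  next : (ℕ × List ℕ) × List ℕ → Instr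
  computable_next : Computable next

/-- The group element that the black box returns when the instruction is executed on the list `L`
of elements received so far; `none` if a position is out of range or the instruction is `halt`. -/
def Instr.exec {G : Type*} [Group G] (L : List G) : Instr → Option G
  | .mul a b => L[a]?.bind fun g => L[b]?.map fun h => g * h
  | .inv a => L[a]?.map fun g => g⁻¹
  | .halt _ => none

/-- `A.Run label input L k out`: with elements of `G` identified by `label`, on integer input
`input` and from the point where the elements received are those of `L`, the algorithm `A`
executes exactly `k` further group operations (multiplications and inversions, each at unit cost)
and then halts with output `out`. -/
inductive GenericAlgorithm.Run (A : GenericAlgorithm) {G : Type*} [Group G] (label : G → ℕ)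
    (input : ℕ × List ℕ) : List G → ℕ → List ℕ → Prop
  | halt (L : List G) (out : List ℕ)
      (h : A.next (input, L.map label) = Instr.halt out) :
      Run A label input L 0 out
  | step (L : List G) (g : G) (k : ℕ) (out : List ℕ)
      (h : (A.next (input, L.map label)).exec L = some g)
      (hrun : Run A label input (L ++ [g]) k out) :
      Run A label input L (k + 1) out

end GenericDL

/-! The method is that of Pohlig and Hellman, applied to all exponents at once, with digits in base
p found from the lowest upwards. Let y_i be x_i mod p^(n_i-1-j), already known. Then β^(p^j) times
the inverse of ∏ α_i^(p^j y_i), over the i with n_i > j, lies in the elementary abelian subgroup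
generated by the α_i^(p^(n_i-1)) with n_i > j. Baby and giant steps (`Win.babyGiant`) find the next
digit of all these x_i in O(p^(ρ/2)) operations, where ρ is the number of such i. One has ρ ≤ r_j,
as G^(p^j) maps onto F_p^ρ (`card_le_rank_powSubgroup`).

It remains to supply α_i^(p^j y_i) online, while j decreases and digits arrive
(`exists_online_chain`). For one exponent x with n digits, form a tree with branching factor w. A
node of height s and index u has block length W = w^s and holds p^(uW) (x mod p^(n-(u+1)W)); the
leaves are the wanted exponents. A child arises from its parent by a shift and the addition of fewer
than w pieces, each being W digits times a fixed power of p. With tables of 2^b p^k, Yao's method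
evaluates a piece in O(W lg p / (s+1)) additions. So a level costs O(n lg p) when s ≥ w, and at most
w times that below. Taking w ≈ (lg n)^(1/3) gives about lg n / lg w levels, while the low levels
contribute only w² ≤ O((lg n)^(2/3)), and the total is O(n lg p · lg n / lg lg n).

This procedure is formulated as a game with free equality tests (`Win`, `win_discreteLog`). A
winning strategy depends only on the pattern of equalities among the elements received, and the
patterns in G are those in the model ∏ Z/p^(n_i) (`eqPattern_iterate_model`). Only finitely many
patterns occur, so a finite table solves all instances (`exists_table`). As only group operations
are charged, the uniform algorithm may search for the first table that passes a simulation of all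
instances in the model, and follow it. The explicit procedure only shows that such a table exists
within the budget. -/

namespace GenericDL

/-! ### Addition chains -/

/-- Every element of `F` is the sum of two positive elements of `B ∪ F`. -/
def RelChain (B : Set ℕ) (F : Finset ℕ) : Prop :=
  ∀ e ∈ F, ∃ a b, (a ∈ B ∨ a ∈ F) ∧ (b ∈ B ∨ b ∈ F) ∧ 0 < a ∧ 0 < b ∧ a + b = e

/-- All elements of `T` can be obtained from those of `B` with at most `c` additions. -/
def Reach (B : Set ℕ) (c : ℕ) (T : Set ℕ) : Prop :=
  ∃ F : Finset ℕ, F.card ≤ c ∧ RelChain B F ∧ T ⊆ B ∪ F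

theorem RelChain.mono {B B' : Set ℕ} {F : Finset ℕ} (h : RelChain B F) (hB : B ⊆ B') :
    RelChain B' F := by
  intro e he
  obtain ⟨a, b, ha, hb, h⟩ := h e he
  exact ⟨a, b, ha.imp_left (@hB a), hb.imp_left (@hB b), h⟩

theorem RelChain.union {B T : Set ℕ} {F F' : Finset ℕ} (h : RelChain B F)
    (h' : RelChain T F') (hT : T ⊆ B ∪ F) : RelChain B (F ∪ F') := by
  intro e he
  have key : ∀ a, a ∈ T ∨ a ∈ F' → a ∈ B ∨ a ∈ F ∪ F' := by
    rintro a (ha | ha)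
    · rcases hT ha with h | h
      · exact Or.inl h
      · exact Or.inr (Finset.mem_union_left _ h)
    · exact Or.inr (Finset.mem_union_right _ ha)
  rcases Finset.mem_union.1 he with he | he
  · obtain ⟨a, b, ha, hb, h⟩ := h e he
    exact ⟨a, b, ha.imp_right (Finset.mem_union_left _), hb.imp_right (Finset.mem_union_left _), h⟩
  · obtain ⟨a, b, ha, hb, h⟩ := h' e he
    exact ⟨a, b, key a ha, key b hb, h⟩

theorem Reach.refl (B : Set ℕ) : Reach B 0 B :=
  ⟨∅, by simp, by simp [RelChain], by simp⟩

theorem Reach.mono {B B' T T' : Set ℕ} {c c' : ℕ} (h : Reach B c T) (hB : B ⊆ B') (hc : c ≤ c')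
    (hT : T' ⊆ T) : Reach B' c' T' := by
  obtain ⟨F, hF, hR, hTF⟩ := h
  exact ⟨F, hF.trans hc, hR.mono hB, (hT.trans hTF).trans (Set.union_subset_union_left _ hB)⟩

theorem Reach.trans {B T T' : Set ℕ} {c c' : ℕ} (h : Reach B c T) (h' : Reach (B ∪ T) c' T') :
    Reach B (c + c') (T ∪ T') := by
  obtain ⟨F, hF, hR, hTF⟩ := h
  obtain ⟨F', hF', hR', hTF'⟩ := h'
  have hBT : B ∪ T ⊆ B ∪ F := Set.union_subset Set.subset_union_left hTF
  refine ⟨F ∪ F', (Finset.card_union_le _ _).trans (by omega), hR.union hR' hBT, ?_⟩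
  rw [Finset.coe_union, ← Set.union_assoc]
  exact Set.union_subset (hTF.trans Set.subset_union_left)
    (hTF'.trans (Set.union_subset_union_left _ hBT))

theorem Reach.union {B T T' : Set ℕ} {c c' : ℕ} (h : Reach B c T) (h' : Reach B c' T') :
    Reach B (c + c') (T ∪ T') :=
  h.trans (h'.mono Set.subset_union_left le_rfl le_rfl)

theorem Reach.biUnion {ι : Type*} {B : Set ℕ} (I : Finset ι) (c : ι → ℕ) (T : ι → Set ℕ)
    (h : ∀ i ∈ I, Reach B (c i) (T i)) : Reach B (∑ i ∈ I, c i) (⋃ i ∈ I, T i) := by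
  classical
  induction I using Finset.induction_on with
  | empty => exact (Reach.refl B).mono le_rfl (by simp) (by simp)
  | insert a s ha ih =>
    rw [Finset.sum_insert ha]
    have := (h a (Finset.mem_insert_self _ _)).union
      (ih fun i hi => h i (Finset.mem_insert_of_mem hi))
    exact this.mono le_rfl le_rfl (by simp)

/-- A zero summand needs no addition, so chains can insist on positive summands. Each summand is
then smaller than the sum, and a chain can be evaluated in increasing order. -/
theorem Reach.add {B : Set ℕ} {a b : ℕ} (ha : a ∈ B) (hb : b ∈ B) : Reach B 1 {a + b} := by
  rcases Nat.eq_zero_or_pos a with rfl | ha'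
  · exact (Reach.refl B).mono le_rfl (by simp) (by simpa using hb)
  rcases Nat.eq_zero_or_pos b with rfl | hb'
  · exact (Reach.refl B).mono le_rfl (by simp) (by simpa using ha)
  refine ⟨{a + b}, by simp, ?_, by simp⟩
  intro e he
  exact ⟨a, b, Or.inl ha, Or.inl hb, ha', hb', (Finset.mem_singleton.1 he).symm⟩

theorem Reach.add_right {B : Set ℕ} {a b c : ℕ} (h : Reach B c {a}) (hb : b ∈ B) :
    Reach B (c + 1) {a + b} :=
  (h.trans (Reach.add (Or.inr rfl) (Or.inl hb))).mono le_rfl le_rfl Set.subset_union_right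

theorem Reach.add_sum {ι : Type*} {B : Set ℕ} {a c : ℕ} (h : Reach B c {a}) (I : Finset ι)
    (g : ι → ℕ) (hg : ∀ i ∈ I, g i ∈ B) : Reach B (c + I.card) {a + ∑ i ∈ I, g i} := by
  classical
  induction I using Finset.induction_on with
  | empty => simpa using h
  | insert i s hi ih =>
    rw [Finset.card_insert_of_notMem hi, Finset.sum_insert hi, add_comm (g i), ← add_assoc,
      ← add_assoc]
    exact (ih fun i hi => hg i (Finset.mem_insert_of_mem hi)).add_right
      (hg i (Finset.mem_insert_self _ _))

/-- Multiplication by a number of `L` bits. -/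
theorem reach_mul {B : Set ℕ} (h0 : 0 ∈ B) {g : ℕ} (hg : g ∈ B) (L : ℕ) :
    ∀ p < 2 ^ L, Reach B (2 * L) {p * g} := by
  induction L with
  | zero =>
    intro p hp
    obtain rfl : p = 0 := by simpa using hp
    exact (Reach.refl B).mono le_rfl le_rfl (by simpa using h0)
  | succ L ih =>
    intro p hp
    have h1 := ih (p / 2) (by rw [pow_succ] at hp; omega)
    have h2 : Reach B (2 * L + 1) {p / 2 * g + p / 2 * g} :=
      (h1.trans (Reach.add (Or.inr rfl) (Or.inr rfl))).mono le_rfl le_rfl Set.subset_union_right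
    rcases Nat.mod_two_eq_zero_or_one p with h | h
    · refine h2.mono le_rfl (by omega) ?_
      rw [← add_mul]
      have : p / 2 + p / 2 = p := by omega
      rw [this]
    · refine (h2.add_right hg).mono le_rfl (by omega) ?_
      have : p / 2 * g + p / 2 * g + g = (p / 2 + p / 2 + 1) * g := by ring
      have h' : p / 2 + p / 2 + 1 = p := by omega
      rw [this, h']

theorem reach_pow_mul {B : Set ℕ} (h0 : 0 ∈ B) {g : ℕ} (hg : g ∈ B) {L p : ℕ} (hp : p < 2 ^ L)
    (W : ℕ) : Reach B (2 * L * W) {e | ∃ a ≤ W, e = p ^ a * g} := by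
  induction W with
  | zero =>
    refine (Reach.refl B).mono le_rfl le_rfl ?_
    rintro e ⟨a, ha, rfl⟩
    obtain rfl : a = 0 := by omega
    simpa using hg
  | succ W ih =>
    have h := ih.trans (reach_mul (g := p ^ W * g) (Or.inl h0) (Or.inr ⟨W, le_rfl, rfl⟩) L p hp)
    refine h.mono le_rfl (by rw [mul_add]; omega) ?_
    rintro e ⟨a, ha, rfl⟩
    rcases Nat.lt_or_ge a (W + 1) with ha' | ha'
    · exact Or.inl ⟨a, by omega, rfl⟩
    · obtain rfl : a = W + 1 := by omega
      right
      rw [pow_succ]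
      exact (by ring : p ^ W * p * g = p * (p ^ W * g))

theorem reach_two_pow_mul {B : Set ℕ} {g : ℕ} (hg : g ∈ B) (N : ℕ) :
    Reach B N {e | ∃ b ≤ N, e = 2 ^ b * g} := by
  induction N with
  | zero =>
    refine (Reach.refl B).mono le_rfl le_rfl ?_
    rintro e ⟨a, ha, rfl⟩
    obtain rfl : a = 0 := by omega
    simpa using hg
  | succ W ih =>
    have h := ih.trans (Reach.add (a := 2 ^ W * g) (b := 2 ^ W * g)
      (Or.inr ⟨W, le_rfl, rfl⟩) (Or.inr ⟨W, le_rfl, rfl⟩))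
    refine h.mono le_rfl le_rfl ?_
    rintro e ⟨a, ha, rfl⟩
    rcases Nat.lt_or_ge a (W + 1) with ha' | ha'
    · exact Or.inl ⟨a, by omega, rfl⟩
    · obtain rfl : a = W + 1 := by omega
      right
      rw [pow_succ]
      exact (by ring : 2 ^ W * 2 * g = 2 ^ W * g + 2 ^ W * g)

/-- Yao's method: a linear combination with coefficients at most `D`. -/
theorem reach_linear_combination {ι : Type*} {B : Set ℕ} (h0 : 0 ∈ B) (I : Finset ι) (g : ι → ℕ)
    (hg : ∀ i ∈ I, g i ∈ B) (D : ℕ) : ∀ d : ι → ℕ, (∀ i ∈ I, d i ≤ D) →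
      Reach B ((I.filter fun i => 0 < d i).card + D)
        {∑ i ∈ I with 0 < d i, g i, ∑ i ∈ I, d i * g i} := by
  classical
  induction D with
  | zero =>
    intro d hd
    refine (Reach.refl B).mono le_rfl (by simp) ?_
    have h1 : ∑ i ∈ I, d i * g i = 0 := Finset.sum_eq_zero fun i hi => by
      rw [Nat.le_zero.1 (hd i hi), zero_mul]
    have h2 : ∑ i ∈ I with 0 < d i, g i = 0 := Finset.sum_eq_zero fun i hi => by
      have := Finset.mem_filter.1 hi
      have := hd i this.1
      omega
    rw [h1, h2]
    simpa using h0
  | succ D ih =>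
    intro d hd
    -- Lower all positive coefficients by one. The running sum over positive coefficients then gains
    -- the terms with d i = 1, and is added once to the combination. Each term thus enters the
    -- running sum once, and each of the D rounds costs one further addition.
    have h := ih (fun i => d i - 1) fun i hi => by have := hd i hi; omega
    set A' := ∑ i ∈ I with 0 < d i - 1, g i
    set R' := ∑ i ∈ I, (d i - 1) * g i
    have e1 : ∑ i ∈ I with 0 < d i, g i = A' + ∑ i ∈ I with d i = 1, g i := by
      rw [← Finset.sum_union]
      · refine Finset.sum_congr ?_ fun _ _ => rfl
        ext i
        simp only [Finset.mem_filter, Finset.mem_union, ← and_or_left]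
        refine and_congr_right fun _ => ?_
        omega
      · rw [Finset.disjoint_filter]
        intros
        omega
    have e2 : ∑ i ∈ I, d i * g i = R' + ∑ i ∈ I with 0 < d i, g i := by
      rw [Finset.sum_filter, ← Finset.sum_add_distrib]
      refine Finset.sum_congr rfl fun i _ => ?_
      split_ifs with hi
      · obtain ⟨k, hk⟩ : ∃ k, d i = k + 1 := ⟨d i - 1, by omega⟩
        rw [hk, Nat.add_sub_cancel, add_mul, one_mul]
      · have : d i = 0 := by omega
        simp [this]
    have e3 : (I.filter fun i => 0 < d i).card =
        (I.filter fun i => 0 < d i - 1).card + (I.filter fun i => d i = 1).card := by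
      rw [← Finset.card_union_of_disjoint]
      · congr 1
        ext i
        simp only [Finset.mem_filter, Finset.mem_union, ← and_or_left]
        refine and_congr_right fun _ => ?_
        omega
      · rw [Finset.disjoint_filter]
        intros
        omega
    have h3 : Reach (B ∪ {A', R'}) (0 + (I.filter fun i => d i = 1).card)
        {A' + ∑ i ∈ I with d i = 1, g i} :=
      Reach.add_sum ((Reach.refl _).mono le_rfl le_rfl (by simp)) _ _
        fun i hi => Or.inl (hg i (Finset.mem_filter.1 hi).1)
    rw [← e1] at h3
    have h4 := h.trans h3
    have h5 := h4.trans (Reach.add (a := R') (b := ∑ i ∈ I with 0 < d i, g i)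
      (Or.inr (Or.inl (Or.inr rfl))) (Or.inr (Or.inr rfl)))
    rw [← e2] at h5
    refine h5.mono le_rfl (by omega) ?_
    rintro e (rfl | rfl)
    · exact Or.inl (Or.inr rfl)
    · exact Or.inr rfl

theorem sum_digits (X D : ℕ) (M : ℕ) :
    ∑ i ∈ Finset.range M, X / D ^ i % D * D ^ i = X % D ^ M := by
  induction M with
  | zero => simp [Nat.mod_one]
  | succ M ih =>
    rw [Finset.sum_range_succ, ih, Nat.mod_pow_succ, mul_comm (D ^ M)]

/-- Multiplication by a number of `N` bits when the multiples by powers of two are available. -/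
theorem reach_mul_of_table {B : Set ℕ} (h0 : 0 ∈ B) {g N : ℕ} (hg : ∀ b ≤ N, 2 ^ b * g ∈ B)
    {c : ℕ} (hc : 0 < c) {X : ℕ} (hX : X < 2 ^ N) : Reach B (N / c + 1 + 2 ^ c) {X * g} := by
  -- Expand X in base 2^c: there are N / c + 1 digits, and c * i ≤ N keeps the powers inside the
  -- table.
  have h := reach_linear_combination h0 (Finset.range (N / c + 1)) (fun i => (2 ^ c) ^ i * g)
    (fun i hi => by
      rw [← pow_mul]
      apply hg
      have : i ≤ N / c := by simpa [Nat.lt_succ_iff] using hi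
      exact (Nat.mul_le_mul_left c this).trans (Nat.mul_div_le N c))
    (2 ^ c) (fun i => X / (2 ^ c) ^ i % 2 ^ c)
    (fun i _ => (Nat.mod_lt _ (by positivity)).le)
  have e : ∑ i ∈ Finset.range (N / c + 1), X / (2 ^ c) ^ i % 2 ^ c * ((2 ^ c) ^ i * g) = X * g := by
    simp_rw [← mul_assoc]
    rw [← Finset.sum_mul, sum_digits, Nat.mod_eq_of_lt]
    refine hX.trans_le ?_
    rw [← pow_mul]
    refine Nat.pow_le_pow_right (by norm_num) ?_
    rw [mul_comm]
    exact (Nat.lt_mul_of_div_lt (Nat.lt_succ_self _) hc).le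
  rw [e] at h
  refine h.mono le_rfl ?_ (by simp)
  gcongr
  exact (Finset.card_filter_le _ _).trans (by simp)

/-! ### Online computation of shifted truncations -/

/-- `p ^ (u * W) * (x mod p ^ (n - (u + 1) * W))`. -/
def shiftTrunc (p n W x u : ℕ) : ℕ := p ^ (u * W) * (x % p ^ (n - (u + 1) * W))

theorem shiftTrunc_eq_zero {p n W u : ℕ} (x : ℕ) (h : n ≤ (u + 1) * W) :
    shiftTrunc p n W x u = 0 := by
  simp [shiftTrunc, Nat.sub_eq_zero_of_le h, Nat.mod_one]

theorem shiftTrunc_mod {p n W u k : ℕ} (x : ℕ) (h : n - (u + 1) * W ≤ k) :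
    shiftTrunc p n W (x % p ^ k) u = shiftTrunc p n W x u := by
  rw [shiftTrunc, Nat.mod_mod_of_dvd _ (pow_dvd_pow p h), shiftTrunc]

theorem shiftTrunc_lt {p n W u : ℕ} (hp : 0 < p) (x : ℕ) :
    shiftTrunc p n W x u < p ^ (n - W) := by
  rcases Nat.lt_or_ge ((u + 1) * W) n with h | h
  · have : n - W = u * W + (n - (u + 1) * W) := by
      rw [add_mul] at *; omega
    rw [this, pow_add, shiftTrunc]
    exact Nat.mul_lt_mul_of_pos_left (Nat.mod_lt _ (by positivity)) (by positivity)
  · rw [shiftTrunc_eq_zero x h]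
    positivity

/-- Both values are truncations of x, shifted. Cutting the child's value at this position leaves
exactly the digits known to the parent, shifted by v further blocks. -/
theorem shiftTrunc_child_mod (p n W w x u v : ℕ) (hv : v < w) :
    shiftTrunc p n W x (u * w + v) % p ^ (n - (w - v) * W) =
      p ^ (v * W) * shiftTrunc p n (w * W) x u := by
  obtain ⟨d, rfl⟩ : ∃ d, w = v + 1 + d := ⟨w - (v + 1), by omega⟩
  have hd : v + 1 + d - v = d + 1 := by omega
  rw [hd, shiftTrunc, shiftTrunc, ← mul_assoc, ← pow_add]
  have h1 : v * W + u * ((v + 1 + d) * W) = (u * (v + 1 + d) + v) * W := by ring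
  rw [h1]
  set a := (u * (v + 1 + d) + v) * W
  have h2 : (u * (v + 1 + d) + v + 1) * W = a + W := by simp only [a]; ring
  have h3 : (u + 1) * ((v + 1 + d) * W) = a + (d + 1) * W := by simp only [a]; ring
  rw [h2, h3]
  rcases Nat.lt_or_ge (n - (d + 1) * W) a with h | h
  · have h4 : n - (a + (d + 1) * W) = 0 := by omega
    rw [h4, pow_zero, Nat.mod_one, mul_zero]
    exact Nat.mod_eq_zero_of_dvd ((pow_dvd_pow p h.le).mul_right _)
  · have h4 : n - (d + 1) * W = a + (n - (a + (d + 1) * W)) := by omega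
    have h5 : n - (a + (d + 1) * W) ≤ n - (a + W) := by
      have : W ≤ (d + 1) * W := Nat.le_mul_of_pos_left W (by omega)
      omega
    rw [h4, pow_add, Nat.mul_mod_mul_left, Nat.mod_mod_of_dvd _ (pow_dvd_pow p h5)]

theorem mod_add_sum_blocks (p V : ℕ) (f : ℕ → ℕ) (hf : ∀ i, f (i + 1) ≤ f i) (t : ℕ) :
    V % p ^ f t + ∑ i ∈ Finset.range t, V % p ^ f i / p ^ f (i + 1) * p ^ f (i + 1) =
      V % p ^ f 0 := by
  induction t with
  | zero => simp
  | succ t ih =>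
    rw [Finset.sum_range_succ, ← ih, ← Nat.mod_mod_of_dvd V (pow_dvd_pow p (hf t))]
    have := Nat.mod_add_div' (V % p ^ f t) (p ^ f (t + 1))
    omega

/-- The fixed powers available on the level with block length `W`. -/
def levelTable (p n L W : ℕ) : Set ℕ :=
  {e | ∃ i b, (i + 1) * W < n ∧ b ≤ L * W ∧ e = 2 ^ b * p ^ (n - (i + 2) * W)}

/-- The fixed powers available. -/
def baseTable (p n L w h : ℕ) : Set ℕ :=
  {e | e = 0 ∨ (∃ a ≤ n, e = p ^ a) ∨ ∃ s < h, e ∈ levelTable p n L (w ^ s)}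

/-- At most n / W powers of p occur, each doubled L * W times, so the bound does not depend on W. -/
theorem reach_levelTable {B : Set ℕ} (p n L W : ℕ) (hW : 0 < W) (hB : ∀ a ≤ n, p ^ a ∈ B) :
    Reach B (n * L) (levelTable p n L W) := by
  have h := Reach.biUnion (B := B) (Finset.range (n / W)) (fun _ => L * W)
    (fun i => {e | ∃ b ≤ L * W, e = 2 ^ b * p ^ (n - (i + 2) * W)})
    (fun i _ => reach_two_pow_mul (hB _ (Nat.sub_le _ _)) _)
  refine h.mono le_rfl ?_ ?_
  · rw [Finset.sum_const, Finset.card_range, smul_eq_mul, mul_comm L, ← mul_assoc]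
    exact Nat.mul_le_mul_right _ (Nat.div_mul_le_self n W)
  · rintro e ⟨i, b, hi, hb, rfl⟩
    simp only [Set.mem_iUnion, Finset.mem_range]
    exact ⟨i, (Nat.le_div_iff_mul_le hW).2 hi.le, b, hb, rfl⟩

theorem reach_baseTable (p n L w h : ℕ) (hw : 0 < w) (hp : p < 2 ^ L) :
    Reach {0, 1} ((2 + h) * (n * L)) (baseTable p n L w h) := by
  have h1 : Reach {0, 1} (2 * L * n) {e | ∃ a ≤ n, e = p ^ a * 1} :=
    reach_pow_mul (by simp) (by simp) hp n
  have h2 := Reach.biUnion (B := {0, 1} ∪ {e | ∃ a ≤ n, e = p ^ a * 1}) (Finset.range h)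
    (fun _ => n * L) (fun s => levelTable p n L (w ^ s))
    (fun s _ => reach_levelTable p n L _ (by positivity)
      fun a ha => Or.inr ⟨a, ha, by simp⟩)
  have h0 := Reach.refl ({0, 1} : Set ℕ)
  refine (h0.union (h1.trans h2)).mono le_rfl ?_ ?_
  · simp only [Finset.sum_const, Finset.card_range, smul_eq_mul]
    apply le_of_eq
    ring
  · rintro e (rfl | ⟨a, ha, rfl⟩ | ⟨s, hs, he⟩)
    · exact Or.inl (by simp)
    · exact Or.inr (Or.inl ⟨a, ha, by simp⟩)
    · right; right
      simp only [Set.mem_iUnion, Finset.mem_range]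
      exact ⟨s, hs, he⟩

/-- Above the shifted parent value, the child's value consists of w - 1 - v further blocks of at
most W digits. Each is a number below 2^(L * W) times a tabulated power of p; it costs one table
multiplication and one addition. -/
theorem reach_child {B : Set ℕ} {p n L w W c : ℕ} (x u v : ℕ) (hB0 : 0 ∈ B) (hc : 0 < c)
    (hp0 : 0 < p) (hp : p < 2 ^ L) (hv : v < w) (hW : levelTable p n L W ⊆ B)
    (hpar : p ^ (v * W) * shiftTrunc p n (w * W) x u ∈ B) :
    Reach B (w * (L * W / c + 1 + 2 ^ c + 1)) {shiftTrunc p n W x (u * w + v)} := by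
  set V := shiftTrunc p n W x (u * w + v) with hV
  set f : ℕ → ℕ := fun i => n - (i + 1) * W with hf
  set t := w - 1 - v with ht
  have e1 : V % p ^ f t = p ^ (v * W) * shiftTrunc p n (w * W) x u := by
    rw [← shiftTrunc_child_mod p n W w x u v hv]
    have : w - v = t + 1 := by omega
    rw [this]
  have hanti : ∀ i, f (i + 1) ≤ f i := fun i =>
    Nat.sub_le_sub_left (Nat.mul_le_mul_right W (by omega)) n
  have e2 := mod_add_sum_blocks p V f hanti t
  -- Since V < p^(n - W) and f 0 = n - W, the topmost cut loses nothing.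
  rw [e1, Nat.mod_eq_of_lt (by simpa [hf] using shiftTrunc_lt hp0 x)] at e2
  have h1 : Reach B (∑ i ∈ Finset.range t, (L * W / c + 1 + 2 ^ c))
      (⋃ i ∈ Finset.range t, {V % p ^ f i / p ^ f (i + 1) * p ^ f (i + 1)}) := by
    apply Reach.biUnion
    intro i _
    rcases Nat.lt_or_ge ((i + 1) * W) n with hi | hi
    · refine reach_mul_of_table hB0 (N := L * W)
        (fun b hb => hW ⟨i, b, hi, hb, rfl⟩) hc ?_
      rw [Nat.div_lt_iff_lt_mul (by positivity)]
      refine (Nat.mod_lt _ (by positivity)).trans_le ?_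
      have h3 : f i ≤ W + f (i + 1) := by
        simp only [hf, add_mul]; omega
      calc p ^ f i ≤ p ^ (W + f (i + 1)) := Nat.pow_le_pow_right hp0 h3
        _ = p ^ W * p ^ f (i + 1) := pow_add _ _ _
        _ ≤ (2 ^ L) ^ W * p ^ f (i + 1) := by gcongr
        _ = 2 ^ (L * W) * p ^ f (i + 1) := by rw [pow_mul]
    · have : f i = 0 := Nat.sub_eq_zero_of_le hi
      rw [this, pow_zero, Nat.mod_one, Nat.zero_div, zero_mul]
      exact (Reach.refl B).mono le_rfl (Nat.zero_le _) (by simpa using hB0)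
  have h2 := h1.trans (Reach.add_sum (a := p ^ (v * W) * shiftTrunc p n (w * W) x u) (c := 0)
    ((Reach.refl _).mono le_rfl le_rfl (by simpa using Or.inl hpar)) (Finset.range t)
    (fun i => V % p ^ f i / p ^ f (i + 1) * p ^ f (i + 1))
    (fun i hi => Or.inr (by
      simp only [Set.mem_iUnion, Set.mem_singleton_iff]
      exact ⟨i, hi, rfl⟩)))
  rw [e2] at h2
  refine h2.mono le_rfl ?_ Set.subset_union_right
  have htw : t ≤ w := by omega
  simp only [Finset.sum_const, Finset.card_range, smul_eq_mul, zero_add]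
  rw [← Nat.mul_add_one]
  gcongr

/-- The additions spent on the block with index `u` and length `W`. -/
theorem reach_node {p n L w W c : ℕ} (hc : 0 < c) (hp0 : 0 < p) (hp : p < 2 ^ L) (hw : 0 < w)
    (Tb : Set ℕ) (h0 : 0 ∈ Tb) (hW : levelTable p n L W ⊆ Tb) (u x : ℕ) :
    Reach (Tb ∪ {e | ∃ a ≤ w * W, e = p ^ a * shiftTrunc p n (w * W) x (u / w)})
      (if (u + 1) * W < n then w * (L * W / c + 1 + 2 ^ c + 1) + 2 * L * W else 0)
      {e | ∃ a ≤ W, e = p ^ a * shiftTrunc p n W x u} := by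
  split_ifs with h
  · have hv : u % w < w := Nat.mod_lt _ hw
    -- The parent keeps its value times p^a for all a ≤ w * W, so the shift by (u % w) * W is
    -- available. The child then prepares its own shifts for the level below.
    have h1 := reach_child
      (B := Tb ∪ {e | ∃ a ≤ w * W, e = p ^ a * shiftTrunc p n (w * W) x (u / w)}) (n := n) (W := W)
      x (u / w) (u % w) (Or.inl h0) hc hp0 hp hv
      (hW.trans Set.subset_union_left) (Or.inr ⟨u % w * W, by gcongr, rfl⟩)
    rw [mul_comm (u / w), Nat.div_add_mod] at h1
    exact (h1.trans (reach_pow_mul (Or.inl (Or.inl h0)) (Or.inr rfl) hp W)).mono le_rfl le_rfl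
      Set.subset_union_right
  · refine (Reach.refl _).mono le_rfl le_rfl ?_
    rintro e ⟨a, -, rfl⟩
    rw [shiftTrunc_eq_zero (u := u) x (not_lt.1 h), mul_zero]
    exact Or.inl h0

/-- Logarithm of the branching factor used for exponents of `n` digits. -/
def branchLog (n : ℕ) : ℕ := Nat.log 2 (Nat.log 2 n) / 3 + 1

/-- Bound on the number of operations spent on a basis element of order `p ^ n`. -/
def expCost (p n : ℕ) : ℕ :=
  15 * (n * (Nat.log 2 p + 1)) * (Nat.log 2 n / branchLog n + 4 ^ branchLog n + 1)

/-! ### Costs of the levels of the block tree -/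

theorem succ_le_two_mul_two_pow_half (s : ℕ) : s + 1 ≤ 2 * 2 ^ (s / 2) := by
  have : s / 2 < 2 ^ (s / 2) := Nat.lt_two_pow_self
  omega

theorem two_pow_half_mul_self_le (s : ℕ) : 2 ^ (s / 2) * 2 ^ (s / 2) ≤ 2 ^ s := by
  rw [← pow_add]
  exact Nat.pow_le_pow_right (by norm_num) (by omega)

/-- The window width s / 2 + 1 balances the two terms of Yao's method: the number of windows is O(L
* W / (s + 1)), and 2^(s/2) is at most √W, which stays O(W) after multiplication by s + 1. -/
theorem tableCost_mul_le {L W s : ℕ} (hL : 0 < L) (hW : 2 ^ s ≤ W) :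
    (L * W / (s / 2 + 1) + 1 + 2 ^ (s / 2 + 1) + 1) * (s + 1) ≤ 10 * (L * W) := by
  have h1 : L * W / (s / 2 + 1) * (s + 1) ≤ 2 * (L * W) := by
    have := Nat.div_mul_le_self (L * W) (s / 2 + 1)
    have h : s + 1 ≤ 2 * (s / 2 + 1) := by omega
    calc _ ≤ L * W / (s / 2 + 1) * (2 * (s / 2 + 1)) := by gcongr
      _ = 2 * (L * W / (s / 2 + 1) * (s / 2 + 1)) := by ring
      _ ≤ _ := by gcongr
  have h2 : (2 + 2 ^ (s / 2 + 1)) * (s + 1) ≤ 8 * (L * W) := by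
    have h3 : 2 + 2 ^ (s / 2 + 1) ≤ 4 * 2 ^ (s / 2) := by
      have : 1 ≤ 2 ^ (s / 2) := Nat.one_le_two_pow
      rw [pow_succ]; omega
    calc _ ≤ 4 * 2 ^ (s / 2) * (2 * 2 ^ (s / 2)) :=
          Nat.mul_le_mul h3 (succ_le_two_mul_two_pow_half s)
      _ = 8 * (2 ^ (s / 2) * 2 ^ (s / 2)) := by ring
      _ ≤ 8 * 2 ^ s := by gcongr; exact two_pow_half_mul_self_le s
      _ ≤ 8 * W := by gcongr
      _ ≤ _ := by gcongr; exact Nat.le_mul_of_pos_left _ hL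
  calc _ = L * W / (s / 2 + 1) * (s + 1) + (2 + 2 ^ (s / 2 + 1)) * (s + 1) := by ring
    _ ≤ _ := by omega

/-- For s ≥ w the saving factor s + 1 of the tables absorbs the factor w for the pieces of a child;
for s < w that factor is paid. The summand 2 covers the shifts by powers of p. -/
theorem levelCost_le {n L W s w : ℕ} (hL : 0 < L) (hW : 2 ^ s ≤ W) :
    n / W * (w * (L * W / (s / 2 + 1) + 1 + 2 ^ (s / 2 + 1) + 1) + 2 * L * W) ≤
      (10 * (if s < w then w else 1) + 2) * (n * L) := by
  set Y := L * W / (s / 2 + 1) + 1 + 2 ^ (s / 2 + 1) + 1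
  have hY : Y * (s + 1) ≤ 10 * (L * W) := tableCost_mul_le hL hW
  have h1 : w * Y ≤ 10 * (if s < w then w else 1) * (L * W) := by
    split_ifs with h
    · have : Y ≤ 10 * (L * W) := (Nat.le_mul_of_pos_right _ (Nat.succ_pos s)).trans hY
      calc w * Y ≤ w * (10 * (L * W)) := by gcongr
        _ = _ := by ring
    · calc w * Y ≤ (s + 1) * Y := by gcongr; omega
        _ = Y * (s + 1) := mul_comm _ _
        _ ≤ _ := by simpa using hY
  set g := if s < w then w else 1
  calc n / W * (w * Y + 2 * L * W) ≤ n / W * (10 * g * (L * W) + 2 * L * W) := by gcongr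
    _ = (10 * g + 2) * (n / W * W * L) := by ring
    _ ≤ _ := by gcongr; exact Nat.div_mul_le_self _ _

theorem sum_ite_lt_le (h w : ℕ) : ∑ s ∈ Finset.range h, (if s < w then w else 1) ≤ w * w + h := by
  calc _ ≤ ∑ s ∈ Finset.range h, ((if s < w then w else 0) + 1) := by
        gcongr with s; split_ifs <;> omega
    _ = (∑ s ∈ Finset.range h with s < w, w) + h := by
        rw [Finset.sum_add_distrib, Finset.sum_filter]; simp
    _ ≤ _ := by
        rw [Finset.sum_const, smul_eq_mul]
        gcongr
        refine (Finset.card_le_card (t := Finset.range w) ?_).trans (by simp)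
        intro s; simp

/-- The exponents needed for the online computation of the powers `p ^ j * (x mod p ^ (n - 1 - j))`,
for `j` decreasing from `n - 1`: the set `S j x` of those computed up to time `j` depends only on
`x mod p ^ (n - 1 - j)`. -/
theorem exists_online_chain (p n : ℕ) (hp0 : 0 < p) :
    ∃ S : ℕ → ℕ → Finset ℕ,
      (∀ j x x', x % p ^ (n - 1 - j) = x' % p ^ (n - 1 - j) → S j x = S j x') ∧
      (∀ j x, S (j + 1) x ⊆ S j x) ∧
      (∀ j x, RelChain {0, 1} (S j x)) ∧
      (∀ j x, p ^ j * (x % p ^ (n - 1 - j)) ∈ ({0, 1} : Set ℕ) ∪ S j x) ∧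
      (∀ j x, p ^ (n - 1) ∈ ({0, 1} : Set ℕ) ∪ S j x) ∧
      ∀ j x, (S j x).card ≤ expCost p n := by
  classical
  set L := Nat.log 2 p + 1 with hLdef
  have hp : p < 2 ^ L := Nat.lt_pow_succ_log_self (by norm_num) p
  set t := branchLog n with htdef
  have ht : 0 < t := Nat.succ_pos _
  set w := 2 ^ t with hw
  have hw0 : 0 < w := by positivity
  set h := Nat.log 2 n / t + 1 with hh
  have htop : n ≤ w ^ h := by
    rw [hw, ← pow_mul]
    refine (Nat.lt_pow_succ_log_self (by norm_num : 1 < 2) n).le.trans ?_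
    refine Nat.pow_le_pow_right (by norm_num) ?_
    rw [mul_comm]
    exact Nat.lt_mul_of_div_lt (Nat.lt_succ_self _) ht
  have h0 : (0 : ℕ) ∈ baseTable p n L w h := Or.inl rfl
  obtain ⟨Fb, hFb, hcb, hTb⟩ := reach_baseTable p n L w h hw0 hp
  have node : ∀ s u x, s < h →
      Reach (baseTable p n L w h ∪
        {e | ∃ a ≤ w * w ^ s, e = p ^ a * shiftTrunc p n (w * w ^ s) x (u / w)})
      (if (u + 1) * w ^ s < n then
        w * (L * w ^ s / (s / 2 + 1) + 1 + 2 ^ (s / 2 + 1) + 1) + 2 * L * w ^ s else 0)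
      {e | ∃ a ≤ w ^ s, e = p ^ a * shiftTrunc p n (w ^ s) x u} := fun s u x hs =>
    reach_node (Nat.succ_pos _) hp0 hp hw0 _ h0 (fun e he => Or.inr (Or.inr ⟨s, hs, he⟩)) u x
  choose! F hF hcF hTF using node
  -- At time j the blocks with j < (u + 1) * w^s are evaluated: they need x only modulo a divisor of
  -- p^(n - 1 - j). Passing this residue to `F` makes the dependence on known digits literal; by
  -- `hpar` it leaves the parent's value unchanged.
  set S : ℕ → ℕ → Finset ℕ := fun j x => Fb ∪ (Finset.range h).biUnion fun s =>
    ((Finset.range n).filter fun u => j < (u + 1) * w ^ s).biUnion fun u =>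
      F s u (x % p ^ (n - (u + 1) * w ^ s)) with hS
  have hbase : ∀ j x, baseTable p n L w h ⊆ ({0, 1} : Set ℕ) ∪ S j x := by
    intro j x
    refine hTb.trans (Set.union_subset_union_right _ ?_)
    exact_mod_cast Finset.subset_union_left
  have hmemF : ∀ j x s u, s < h → u < n → j < (u + 1) * w ^ s →
      F s u (x % p ^ (n - (u + 1) * w ^ s)) ⊆ S j x := by
    intro j x s u hs hu hj
    refine Finset.Subset.trans ?_ Finset.subset_union_right
    refine Finset.Subset.trans ?_ (Finset.subset_biUnion_of_mem _ (Finset.mem_range.2 hs))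
    exact Finset.subset_biUnion_of_mem (fun u => F s u (x % p ^ (n - (u + 1) * w ^ s)))
      (Finset.mem_filter.2 ⟨Finset.mem_range.2 hu, hj⟩)
  have hpar : ∀ s u x, shiftTrunc p n (w * w ^ s) (x % p ^ (n - (u + 1) * w ^ s)) (u / w) =
      shiftTrunc p n (w * w ^ s) x (u / w) := by
    intro s u x
    apply shiftTrunc_mod
    have h1 : u < (u / w + 1) * w := Nat.lt_mul_of_div_lt (Nat.lt_succ_self _) hw0
    have : (u + 1) * w ^ s ≤ (u / w + 1) * w * w ^ s := Nat.mul_le_mul_right _ h1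
    rw [← mul_assoc]
    omega
  -- Induction downwards from level h, where w^h ≥ n makes all values zero and the root is free.
  have hblocks : ∀ j x d s, s + d = h → ∀ u, j < (u + 1) * w ^ s →
      {e | ∃ a ≤ w ^ s, e = p ^ a * shiftTrunc p n (w ^ s) x u} ⊆ ({0, 1} : Set ℕ) ∪ S j x := by
    intro j x d
    induction d with
    | zero =>
      rintro s hs u - e ⟨a, -, rfl⟩
      obtain rfl : s = h := by omega
      rw [shiftTrunc_eq_zero x (htop.trans (Nat.le_mul_of_pos_left _ (Nat.succ_pos u))), mul_zero]
      exact Or.inl (by simp)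
    | succ d ih =>
      rintro s hs u hj
      rcases Nat.lt_or_ge u n with hu | hu
      · have hs' : s < h := by omega
        have h1 := hTF s u (x % p ^ (n - (u + 1) * w ^ s)) hs'
        rw [shiftTrunc_mod x le_rfl, hpar] at h1
        refine h1.trans (Set.union_subset (Set.union_subset (hbase j x) ?_) ?_)
        · have := ih (s + 1) (by omega) (u / w) ?_
          · rwa [pow_succ'] at this
          · have h1 : u < (u / w + 1) * w := Nat.lt_mul_of_div_lt (Nat.lt_succ_self _) hw0
            have : (u + 1) * w ^ s ≤ (u / w + 1) * w * w ^ s := Nat.mul_le_mul_right _ h1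
            rw [pow_succ', ← mul_assoc]
            omega
        · exact (Finset.coe_subset.2 (hmemF j x s u hs' hu hj)).trans Set.subset_union_right
      · rintro e ⟨a, -, rfl⟩
        have : u + 1 ≤ (u + 1) * w ^ s := Nat.le_mul_of_pos_right _ (by positivity)
        rw [shiftTrunc_eq_zero x (by omega), mul_zero]
        exact Or.inl (by simp)
  refine ⟨S, ?_, ?_, ?_, ?_, ?_, ?_⟩
  · intro j x x' hx
    simp only [hS]
    congr 1
    refine Finset.biUnion_congr rfl fun s _ => Finset.biUnion_congr rfl fun u hu => ?_
    have hj := (Finset.mem_filter.1 hu).2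
    have hd : p ^ (n - (u + 1) * w ^ s) ∣ p ^ (n - 1 - j) := pow_dvd_pow p (by omega)
    rw [← Nat.mod_mod_of_dvd x hd, hx, Nat.mod_mod_of_dvd x' hd]
  · intro j x
    refine Finset.union_subset_union_right ?_
    refine Finset.biUnion_mono fun s _ => Finset.biUnion_subset_biUnion_of_subset_left _ ?_
    exact Finset.monotone_filter_right _ fun u _ hu => (Nat.lt_succ_self j).trans hu
  · intro j x e he
    have hS' : ∀ a, a ∈ ({0, 1} : Set ℕ) ∪ S j x → a ∈ ({0, 1} : Set ℕ) ∨ a ∈ S j x :=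
      fun a ha => ha.imp_right Finset.mem_coe.1
    rcases Finset.mem_union.1 he with he | he
    · obtain ⟨a, b, ha, hb, hab⟩ := hcb e he
      exact ⟨a, b, ha.imp_right (Finset.mem_union_left _),
        hb.imp_right (Finset.mem_union_left _), hab⟩
    · simp only [Finset.mem_biUnion, Finset.mem_range, Finset.mem_filter] at he
      obtain ⟨s, hs, u, ⟨hu, hj⟩, he⟩ := he
      obtain ⟨a, b, ha, hb, hab⟩ := hcF s u _ hs e he
      rw [hpar] at ha hb
      have key : ∀ a, (a ∈ baseTable p n L w h ∪
          {e | ∃ a ≤ w * w ^ s, e = p ^ a * shiftTrunc p n (w * w ^ s) x (u / w)} ∨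
          a ∈ F s u (x % p ^ (n - (u + 1) * w ^ s))) → a ∈ ({0, 1} : Set ℕ) ∨ a ∈ S j x := by
        rintro a ((ha | ha) | ha)
        · exact hS' a (hbase j x ha)
        · refine hS' a (hblocks j x (h - (s + 1)) (s + 1) (by omega) (u / w) ?_ ?_)
          · have h1 : u < (u / w + 1) * w := Nat.lt_mul_of_div_lt (Nat.lt_succ_self _) hw0
            have : (u + 1) * w ^ s ≤ (u / w + 1) * w * w ^ s := Nat.mul_le_mul_right _ h1
            rw [pow_succ', ← mul_assoc]
            omega
          · rwa [pow_succ']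
        · exact Or.inr (hmemF j x s u hs hu hj ha)
      exact ⟨a, b, key a ha, key b hb, hab⟩
  · intro j x
    -- On level 0 blocks have length 1, and block j is the wanted exponent.
    refine hblocks j x h 0 (by omega) j (by simp) ⟨0, by simp, ?_⟩
    simp only [shiftTrunc, pow_zero, mul_one, one_mul]
    congr 3
    omega
  · intro j x
    exact hbase j x (Or.inr (Or.inl ⟨n - 1, Nat.sub_le _ _, rfl⟩))
  · intro j x
    have hL : 0 < L := Nat.succ_pos _
    have hlevel : ∀ s < h, (((Finset.range n).filter fun u => j < (u + 1) * w ^ s).biUnion fun u =>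
        F s u (x % p ^ (n - (u + 1) * w ^ s))).card ≤
          (10 * (if s < w then w else 1) + 2) * (n * L) := by
      intro s hs
      have hW0 : 0 < w ^ s := by positivity
      refine (Finset.card_biUnion_le.trans (Finset.sum_le_sum fun u _ => hF s u _ hs)).trans ?_
      refine (Finset.sum_le_sum_of_subset (Finset.filter_subset _ _)).trans ?_
      rw [← Finset.sum_filter, Finset.sum_const, smul_eq_mul]
      refine (Nat.mul_le_mul_right _ ?_).trans (levelCost_le (n := n) (w := w) hL
        (W := w ^ s) (s := s) (Nat.pow_le_pow_left (Nat.le_self_pow ht.ne' 2) s))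
      refine (Finset.card_le_card (t := Finset.range (n / w ^ s)) ?_).trans (by simp)
      intro u hu
      rw [Finset.mem_range]
      exact (Nat.le_div_iff_mul_le hW0).2 (Finset.mem_filter.1 hu).2.le
    have h1 : (S j x).card ≤ (2 + h) * (n * L) +
        ∑ s ∈ Finset.range h, (10 * (if s < w then w else 1) + 2) * (n * L) :=
      (Finset.card_union_le _ _).trans (Nat.add_le_add hFb
        (Finset.card_biUnion_le.trans
          (Finset.sum_le_sum fun s hs => hlevel s (Finset.mem_range.1 hs))))
    refine h1.trans ?_
    rw [← Finset.sum_mul, Finset.sum_add_distrib, ← Finset.mul_sum, Finset.sum_const,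
      Finset.card_range, smul_eq_mul, ← add_mul]
    have h2 := sum_ite_lt_le h w
    have h3 : w * w = 4 ^ t := by
      rw [hw, ← mul_pow]
      norm_num
    -- The factor of n * L is at most 2 + h + 10 (4^t + h) + 2h; with h = f + 1, where f = Nat.log 2
    -- n / t, this is 15 + 13 f + 10 · 4^t, whence the 15.
    rw [expCost, mul_right_comm, ← htdef]
    refine Nat.mul_le_mul_right _ ?_
    rw [h3] at h2
    clear_value h
    generalize Nat.log 2 n / t = f at hh ⊢
    omega

/-! ### Determining a hidden parameter with group operations and equality tests -/

/-- `Win L S T`: if the functions in `L` give the available group elements in dependence on a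
hidden parameter from `S`, then the parameter can be determined with `T` group operations and any
number of equality tests. -/
inductive Win {Ω G : Type*} [Group G] : List (Ω → G) → Set Ω → ℕ → Prop
  | done (L : List (Ω → G)) (S : Set Ω) (T : ℕ) (h : S.Subsingleton) : Win L S T
  | mul (L : List (Ω → G)) (S : Set Ω) (T : ℕ) (f e e' : Ω → G) (he : e ∈ L) (he' : e' ∈ L)
      (hf : ∀ x ∈ S, f x = e x * e' x) (h : Win (L ++ [f]) S T) : Win L S (T + 1)
  | inv (L : List (Ω → G)) (S : Set Ω) (T : ℕ) (f e : Ω → G) (he : e ∈ L)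
      (hf : ∀ x ∈ S, f x = (e x)⁻¹) (h : Win (L ++ [f]) S T) : Win L S (T + 1)
  | split (L : List (Ω → G)) (S : Set Ω) (T : ℕ) (e e' : Ω → G) (he : e ∈ L) (he' : e' ∈ L)
      (h : Win L {x ∈ S | e x = e' x} T) (h' : Win L {x ∈ S | e x ≠ e' x} T) : Win L S T

namespace Win

variable {Ω G : Type*} [Group G] {L : List (Ω → G)} {S : Set Ω} {T : ℕ}

theorem mono (h : Win L S T) : ∀ {L' : List (Ω → G)} {S' : Set Ω} {T' : ℕ}, L ⊆ L' → S' ⊆ S →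
    T ≤ T' → Win L' S' T' := by
  induction h with
  | done L S T h => exact fun _ hS _ => done _ _ _ (h.anti hS)
  | mul L S T f e e' he he' hf h ih =>
    intro L' S' T' hL hS hT
    obtain ⟨T', rfl⟩ : ∃ k, T' = k + 1 := ⟨T' - 1, by omega⟩
    exact mul _ _ _ f e e' (hL he) (hL he') (fun x hx => hf x (hS hx))
      (ih (List.append_subset.2 ⟨fun a ha => List.mem_append_left _ (hL ha),
        List.subset_append_right _ _⟩) hS (by omega))
  | inv L S T f e he hf h ih =>
    intro L' S' T' hL hS hT
    obtain ⟨T', rfl⟩ : ∃ k, T' = k + 1 := ⟨T' - 1, by omega⟩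
    exact inv _ _ _ f e (hL he) (fun x hx => hf x (hS hx))
      (ih (List.append_subset.2 ⟨fun a ha => List.mem_append_left _ (hL ha),
        List.subset_append_right _ _⟩) hS (by omega))
  | split L S T e e' he he' h h' ih ih' =>
    intro L' S' T' hL hS hT
    exact split _ _ _ e e' (hL he) (hL he') (ih hL (fun x hx => ⟨hS hx.1, hx.2⟩) hT)
      (ih' hL (fun x hx => ⟨hS hx.1, hx.2⟩) hT)

/-- Test a family of equalities of which at least one holds. -/
theorem splitAll {κ : Type*} (P : Finset κ) (f g : κ → Ω → G)
    (hf : ∀ k ∈ P, f k ∈ L) (hg : ∀ k ∈ P, g k ∈ L) :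
    ∀ S : Set Ω, (∀ x ∈ S, ∃ k ∈ P, f k x = g k x) →
      (∀ k ∈ P, Win L {x ∈ S | f k x = g k x} T) → Win L S T := by
  classical
  induction P using Finset.induction_on with
  | empty =>
    intro S hS _
    exact done _ _ _ fun x hx => by simpa using hS x hx
  | insert a P ha ih =>
    intro S hS hW
    refine split _ _ _ (f a) (g a) (hf a (Finset.mem_insert_self _ _))
      (hg a (Finset.mem_insert_self _ _)) (hW a (Finset.mem_insert_self _ _)) ?_
    refine ih (fun k hk => hf k (Finset.mem_insert_of_mem hk))
      (fun k hk => hg k (Finset.mem_insert_of_mem hk)) _ ?_ ?_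
    · rintro x ⟨hx, hne⟩
      obtain ⟨k, hk, hkx⟩ := hS x hx
      rcases Finset.mem_insert.1 hk with rfl | hk
      · exact absurd hkx hne
      · exact ⟨k, hk, hkx⟩
    · intro k hk
      exact (hW k (Finset.mem_insert_of_mem hk)).mono (List.Subset.refl _)
        (fun x hx => ⟨hx.1.1, hx.2⟩) le_rfl

/-- Compute a finite family of elements, each of which is a product of two earlier ones. -/
theorem compute {ι : Type*} (f : ι → Ω → G) (μ : ι → ℕ) (c : ℕ) :
    ∀ (F : Finset ι) (L : List (Ω → G)), F.card = c →
      (∀ t ∈ F, ∃ a b, (a ∈ L ∨ ∃ t' ∈ F, μ t' < μ t ∧ a = f t') ∧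
        (b ∈ L ∨ ∃ t' ∈ F, μ t' < μ t ∧ b = f t') ∧ ∀ x ∈ S, f t x = a x * b x) →
      (∀ L', L ⊆ L' → (∀ t ∈ F, f t ∈ L') → Win L' S T) → Win L S (T + c) := by
  classical
  induction c with
  | zero =>
    intro F L hF _ hW
    rw [Finset.card_eq_zero] at hF
    subst hF
    exact hW L (List.Subset.refl _) (by simp)
  | succ c ih =>
    intro F L hF hstep hW
    -- An element of least measure has both operands in L already.
    have hne : F.Nonempty := Finset.card_pos.1 (by omega)
    obtain ⟨t, ht, hmin⟩ := F.exists_min_image μ hne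
    obtain ⟨a, b, ha, hb, hab⟩ := hstep t ht
    have key : ∀ a, (a ∈ L ∨ ∃ t' ∈ F, μ t' < μ t ∧ a = f t') → a ∈ L := by
      rintro a (ha | ⟨t', ht', hlt, -⟩)
      · exact ha
      · exact absurd hlt (hmin t' ht').not_gt
    refine mul _ _ _ (f t) a b (key a ha) (key b hb) hab ?_
    have hL : L ⊆ L ++ [f t] := List.subset_append_left _ _
    have hft : f t ∈ L ++ [f t] := by simp
    refine ih (F.erase t) (L ++ [f t]) (by rw [Finset.card_erase_of_mem ht]; omega) ?_ ?_
    · intro s hs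
      obtain ⟨a, b, ha, hb, hab⟩ := hstep s (Finset.mem_of_mem_erase hs)
      have key : ∀ a, (a ∈ L ∨ ∃ t' ∈ F, μ t' < μ s ∧ a = f t') →
          (a ∈ L ++ [f t] ∨ ∃ t' ∈ F.erase t, μ t' < μ s ∧ a = f t') := by
        rintro a (ha | ⟨t', ht', hlt, rfl⟩)
        · exact Or.inl (hL ha)
        · by_cases h : t' = t
          · subst h
            exact Or.inl hft
          · exact Or.inr ⟨t', Finset.mem_erase.2 ⟨h, ht'⟩, hlt, rfl⟩
      exact ⟨a, b, key a ha, key b hb, hab⟩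
    · intro L' hLL' hF'
      refine hW L' (List.Subset.trans hL hLL') fun s hs => ?_
      by_cases h : s = t
      · subst h
        exact hLL' hft
      · exact hF' s (Finset.mem_erase.2 ⟨h, hs⟩)

theorem mulStep (f : Ω → G) {e e' : Ω → G} (he : e ∈ L) (he' : e' ∈ L)
    (hf : ∀ x ∈ S, f x = e x * e' x) (hW : ∀ L', L ⊆ L' → f ∈ L' → Win L' S T) :
    Win L S (T + 1) :=
  mul _ _ _ f e e' he he' hf (hW _ (List.subset_append_left _ _) (by simp))

theorem invStep (f : Ω → G) {e : Ω → G} (he : e ∈ L)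
    (hf : ∀ x ∈ S, f x = (e x)⁻¹) (hW : ∀ L', L ⊆ L' → f ∈ L' → Win L' S T) :
    Win L S (T + 1) :=
  inv _ _ _ f e he hf (hW _ (List.subset_append_left _ _) (by simp))

end Win

/-! ### Baby steps and giant steps -/

section Comm

variable {Ω G : Type*} [CommGroup G] {S : Set Ω} {T : ℕ}

theorem Win.prod {ι : Type*} (I : Finset ι) (g : ι → Ω → G) :
    ∀ {L : List (Ω → G)} {T : ℕ}, (fun _ => 1) ∈ L → (∀ i ∈ I, g i ∈ L) →
      (∀ L', L ⊆ L' → (fun x => ∏ i ∈ I, g i x) ∈ L' → Win L' S T) → Win L S (T + I.card) := by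
  classical
  induction I using Finset.induction_on with
  | empty =>
    intro L T h1 _ hW
    exact hW L (List.Subset.refl _) (by simpa using h1)
  | insert i I hi ih =>
    intro L T h1 hg hW
    rw [Finset.card_insert_of_notMem hi, add_comm I.card, ← add_assoc]
    refine ih h1 (fun k hk => hg k (Finset.mem_insert_of_mem hk)) fun L' hL hP => ?_
    refine Win.mulStep (fun x => ∏ i ∈ insert i I, g i x) (hL (hg i (Finset.mem_insert_self _ _)))
      hP (fun x _ => Finset.prod_insert hi) fun L'' hL' h => hW L'' (List.Subset.trans hL hL') h

/-- The residue D of a - 1 - d modulo p is below a * b, so D = a * w + s with w < b and s < a. Then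
d + a * w ≡ a - 1 - s, which lies in the range of u. -/
theorem exists_digit_match {p a b : ℕ} (ha : 0 < a) (hp : 0 < p) (hab : p ≤ a * b) (d : ℕ) :
    ∃ u < a, ∃ w < b, d + a * w ≡ u [MOD p] := by
  obtain ⟨k, hk⟩ : ∃ k, d ≤ p * k := ⟨d, Nat.le_mul_of_pos_left d hp⟩
  set D := (p * k - d + (a - 1)) % p with hD
  have hDp : D < p := Nat.mod_lt _ hp
  have hu : D % a < a := Nat.mod_lt _ ha
  refine ⟨a - 1 - D % a, by omega, D / a, ?_, ?_⟩
  · exact Nat.div_lt_of_lt_mul (hDp.trans_le hab)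
  · have h1 : D ≡ p * k - d + (a - 1) [MOD p] := Nat.mod_modEq _ _
    have h2 : a * (D / a) + D % a = D := Nat.div_add_mod D a
    apply Nat.ModEq.add_right_cancel' (D % a)
    have h3 : d + a * (D / a) + D % a = d + D := by omega
    have h4 : a - 1 - D % a + D % a = a - 1 := by omega
    rw [h3, h4]
    refine (h1.add_left d).trans ?_
    have h5 : d + (p * k - d + (a - 1)) = a - 1 + p * k := by omega
    rw [h5]
    exact Nat.add_mul_mod_self_left _ _ _

/-- Baby steps and giant steps in an elementary abelian group. -/
theorem Win.babyGiant {r p : ℕ} (hp : 0 < p) (e : Fin r → G) (he : ∀ i, e i ^ p = 1)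
    (R : Finset (Fin r)) (hR : ∀ i, i ∉ R → e i = 1) (a b : Fin r → ℕ)
    (ha : ∀ i, 0 < a i) (hb : ∀ i, 0 < b i) (hab : ∀ i ∈ R, p ≤ a i * b i)
    (d : Ω → Fin r → ℕ) (γ : Ω → G) (hγ : ∀ x ∈ S, γ x = ∏ i, e i ^ d x i)
    {L : List (Ω → G)} (h1 : (fun _ => 1) ∈ L) (heL : ∀ i, (fun _ => e i) ∈ L) (hγL : γ ∈ L)
    (hW : ∀ L', L ⊆ L' → ∀ D : Fin r → ℕ,
      Win L' {x ∈ S | ∏ i, e i ^ d x i = ∏ i, e i ^ D i} T) :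
    Win L S (T + ∏ i, b i + R.card + ∏ i, a i) := by
  classical
  set U := Fintype.piFinset fun i => Finset.range (a i) with hU
  set V := Fintype.piFinset fun i => Finset.range (b i) with hV
  have hUc : U.card = ∏ i, a i := by simp [hU]
  have hVc : V.card = ∏ i, b i := by simp [hV]
  have hmemU : ∀ u, u ∈ U ↔ ∀ i, u i < a i := by simp [hU]
  have hmemV : ∀ u, u ∈ V ↔ ∀ i, u i < b i := by simp [hV]
  have hdec : ∀ (q : Fin r → G) (u : Fin r → ℕ) i, u i ≠ 0 →
      ∏ k, q k ^ u k = (∏ k, q k ^ (Function.update u i (u i - 1)) k) * q i := by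
    intro q u i hi
    rw [← Finset.mul_prod_erase _ _ (Finset.mem_univ i),
      ← Finset.mul_prod_erase Finset.univ (fun k => q k ^ (Function.update u i (u i - 1)) k)
        (Finset.mem_univ i), Function.update_self, mul_right_comm, ← pow_succ,
      Nat.sub_add_cancel (Nat.pos_of_ne_zero hi)]
    congr 1
    refine Finset.prod_congr rfl fun k hk => ?_
    rw [Function.update_of_ne (Finset.ne_of_mem_erase hk)]
  have hmeas : ∀ (u : Fin r → ℕ) i, u i ≠ 0 →
      ∑ k, Function.update u i (u i - 1) k < ∑ k, u k := by
    intro u i hi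
    refine Finset.sum_lt_sum (fun k _ => ?_) ⟨i, Finset.mem_univ i, by simp; omega⟩
    by_cases h : k = i
    · subst h; simp
    · rw [Function.update_of_ne h]
  have hupd : ∀ (u : Fin r → ℕ) i k, Function.update u i (u i - 1) k ≤ u k := by
    intro u i k
    by_cases h : k = i
    · subst h; simp
    · rw [Function.update_of_ne h]
  rw [← hUc]
  -- Baby steps: lowering one coordinate of u gives an earlier product, so each vector in the box
  -- costs one multiplication. The giant steps are enumerated in the same way.
  refine Win.compute (fun u _ => ∏ k, e k ^ u k) (fun u => ∑ k, u k) U.card U L rfl ?_ ?_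
  · intro u hu
    by_cases h : ∃ i, u i ≠ 0
    · obtain ⟨i, hi⟩ := h
      refine ⟨_, _, Or.inr ⟨Function.update u i (u i - 1), ?_, hmeas u i hi, rfl⟩,
        Or.inl (heL i), fun x _ => hdec e u i hi⟩
      exact (hmemU _).2 fun k => (hupd u i k).trans_lt ((hmemU u).1 hu k)
    · push Not at h
      exact ⟨_, _, Or.inl h1, Or.inl h1, fun x _ => by simp [h]⟩
  intro L₁ hL₁ hUL
  -- Each stride e i ^ a i is one multiplication beyond the baby step e i ^ (a i - 1).
  refine Win.compute (fun i _ => e i ^ a i) (fun _ => 0) R.card R L₁ rfl ?_ ?_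
  · intro i _
    refine ⟨_, _, Or.inl (hUL (fun k => if k = i then a i - 1 else 0) ?_), Or.inl (hL₁ (heL i)),
      fun x _ => ?_⟩
    · rw [hmemU]
      intro k
      have := ha i
      have := ha k
      split_ifs with h
      · subst h; omega
      · omega
    · have : ∏ k, e k ^ (if k = i then a i - 1 else 0) = e i ^ (a i - 1) := by
        rw [Finset.prod_eq_single i] <;> simp +contextual
      rw [this, ← pow_succ, Nat.sub_add_cancel (ha i)]
  intro L₂ hL₂ hRL
  rw [← hVc]
  have hgiant : ∀ i, (fun _ => e i ^ a i) ∈ L₂ := by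
    intro i
    by_cases hi : i ∈ R
    · exact hRL i hi
    · simpa [hR i hi] using hL₂ (hL₁ h1)
  refine Win.compute (fun w x => γ x * ∏ k, (e k ^ a k) ^ w k) (fun u => ∑ k, u k) V.card V L₂ rfl
    ?_ ?_
  · intro u hu
    by_cases h : ∃ i, u i ≠ 0
    · obtain ⟨i, hi⟩ := h
      refine ⟨_, _, Or.inr ⟨Function.update u i (u i - 1), ?_, hmeas u i hi, rfl⟩,
        Or.inl (hgiant i), fun x _ => ?_⟩
      · exact (hmemV _).2 fun k => (hupd u i k).trans_lt ((hmemV u).1 hu k)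
      · rw [hdec (fun k => e k ^ a k) u i hi, mul_assoc]
    · push Not at h
      exact ⟨_, _, Or.inl (hL₂ (hL₁ hγL)), Or.inl (hL₂ (hL₁ h1)), fun x _ => by simp [h]⟩
  intro L₃ hL₃ hVL
  have hpow : ∀ i k l, k ≡ l [MOD p] → e i ^ k = e i ^ l := fun i k l h =>
    pow_eq_pow_iff_modEq.2 (h.of_dvd (orderOf_dvd_of_pow_eq_one (he i)))
  refine Win.splitAll (U ×ˢ V) (fun k _ => ∏ i, e i ^ k.1 i)
    (fun k x => γ x * ∏ i, (e i ^ a i) ^ k.2 i)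
    (fun k hk => hL₃ (hL₂ (hUL _ (Finset.mem_product.1 hk).1)))
    (fun k hk => hVL _ (Finset.mem_product.1 hk).2) S ?_ ?_
  · intro x hx
    have hex : ∀ i, ∃ u w, u < a i ∧ w < b i ∧ e i ^ u = e i ^ (d x i + a i * w) := by
      intro i
      by_cases hi : i ∈ R
      · obtain ⟨u, hu, w, hw, h⟩ := exists_digit_match (ha i) hp (hab i hi) (d x i)
        exact ⟨u, w, hu, hw, (hpow i _ _ h).symm⟩
      · exact ⟨0, 0, ha i, hb i, by simp [hR i hi]⟩
    choose u w hu hw h using hex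
    refine ⟨(u, w), Finset.mem_product.2 ⟨(hmemU u).2 hu, (hmemV w).2 hw⟩, ?_⟩
    simp only
    rw [hγ x hx, ← Finset.prod_mul_distrib]
    refine Finset.prod_congr rfl fun i _ => ?_
    rw [h i, pow_add, pow_mul]
  · rintro ⟨u, w⟩ -
    -- The exponent stands for u i - a i * w i modulo p, written without subtraction.
    refine (hW L₃ (List.Subset.trans hL₁ (List.Subset.trans hL₂ hL₃))
      fun i => u i + (p - 1) * (a i * w i)).mono (List.Subset.refl _) ?_ le_rfl
    rintro x ⟨hx, h⟩
    refine ⟨hx, ?_⟩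
    simp only at h
    rw [hγ x hx] at h
    have h2 : (∏ i, e i ^ (u i + (p - 1) * (a i * w i))) * ∏ i, (e i ^ a i) ^ w i =
        ∏ i, e i ^ u i := by
      rw [← Finset.prod_mul_distrib]
      refine Finset.prod_congr rfl fun i _ => ?_
      rw [← pow_mul, ← pow_add]
      apply hpow
      obtain ⟨q, rfl⟩ : ∃ q, p = q + 1 := ⟨p - 1, by omega⟩
      have : u i + (q + 1 - 1) * (a i * w i) + a i * w i = u i + (q + 1) * (a i * w i) := by
        rw [Nat.add_sub_cancel]; ring
      rw [this]
      exact Nat.add_mul_mod_self_left _ _ _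
    exact mul_right_cancel (h.symm.trans h2.symm)

end Comm

/-- Bound on the number of operations spent on one digit of each of `ρ` exponents. -/
def stepCost (p ρ : ℕ) : ℕ :=
  2 * (p ^ (ρ / 2) * (Nat.sqrt p + 1) ^ (ρ % 2)) + 2 * ρ + 2

/-- Inserting an index swaps the two families, so the one with the smaller product receives the
factor p. -/
theorem exists_balanced_pow {r p : ℕ} (hp : 0 < p) (R : Finset (Fin r)) :
    ∃ a b : Fin r → ℕ, (∀ i, 0 < a i) ∧ (∀ i, 0 < b i) ∧ (∀ i ∈ R, p ≤ a i * b i) ∧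
      (∀ i, i ∉ R → a i = 1 ∧ b i = 1) ∧
      ∏ i, a i = p ^ ((R.card + 1) / 2) ∧ ∏ i, b i = p ^ (R.card / 2) := by
  induction R using Finset.induction_on with
  | empty => exact ⟨fun _ => 1, fun _ => 1, by simp⟩
  | insert i R hi ih =>
    obtain ⟨a, b, ha, hb, hab, h1, hpa, hpb⟩ := ih
    have hprod : ∀ (q : ℕ) (f : Fin r → ℕ), f i = 1 →
        ∏ k, Function.update f i q k = q * ∏ k, f k := by
      intro q f hf
      rw [Finset.prod_update_of_mem (Finset.mem_univ i), ← Finset.mul_prod_erase Finset.univ f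
        (Finset.mem_univ i), hf, one_mul, Finset.sdiff_singleton_eq_erase]
    refine ⟨Function.update b i p, Function.update a i 1, ?_, ?_, ?_, ?_, ?_, ?_⟩
    · intro k
      by_cases h : k = i
      · subst h; simpa
      · simpa [h] using hb k
    · intro k
      by_cases h : k = i
      · subst h; simp
      · simpa [h] using ha k
    · intro k hk
      by_cases h : k = i
      · subst h; simp
      · simpa [h, mul_comm] using hab k (Finset.mem_of_mem_insert_of_ne hk h)
    · intro k hk
      rw [Finset.mem_insert, not_or] at hk
      simpa [hk.1] using (h1 k hk.2).symm
    · rw [hprod p b (h1 i hi).2, hpb, Finset.card_insert_of_notMem hi, ← pow_succ']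
      congr 1
      omega
    · rw [hprod 1 a (h1 i hi).1, hpa, Finset.card_insert_of_notMem hi, one_mul]

/-- For odd cardinality the alternating assignment alone would be too large by about √p; one
coordinate is therefore split as ⌊√p⌋ + 1 on both sides. -/
theorem exists_balanced {r p : ℕ} (hp : 0 < p) (R : Finset (Fin r)) :
    ∃ a b : Fin r → ℕ, (∀ i, 0 < a i) ∧ (∀ i, 0 < b i) ∧ (∀ i ∈ R, p ≤ a i * b i) ∧
      ∏ i, a i ≤ p ^ (R.card / 2) * (Nat.sqrt p + 1) ^ (R.card % 2) ∧
      ∏ i, b i ≤ p ^ (R.card / 2) * (Nat.sqrt p + 1) ^ (R.card % 2) := by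
  rcases Nat.mod_two_eq_zero_or_one R.card with h | h
  · obtain ⟨a, b, ha, hb, hab, -, hpa, hpb⟩ := exists_balanced_pow hp R
    refine ⟨a, b, ha, hb, hab, ?_, ?_⟩
    · rw [hpa, h, pow_zero, mul_one]
      apply le_of_eq
      congr 1
      omega
    · rw [hpb, h, pow_zero, mul_one]
  · obtain ⟨i, hi⟩ : R.Nonempty := Finset.card_pos.1 (by omega)
    obtain ⟨a, b, ha, hb, hab, h1, hpa, hpb⟩ := exists_balanced_pow hp (R.erase i)
    have hi1 := h1 i (Finset.notMem_erase i R)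
    have hprod : ∀ (q : ℕ) (f : Fin r → ℕ), f i = 1 →
        ∏ k, Function.update f i q k = q * ∏ k, f k := by
      intro q f hf
      rw [Finset.prod_update_of_mem (Finset.mem_univ i), ← Finset.mul_prod_erase Finset.univ f
        (Finset.mem_univ i), hf, one_mul, Finset.sdiff_singleton_eq_erase]
    rw [Finset.card_erase_of_mem hi] at hpa hpb
    refine ⟨Function.update a i (Nat.sqrt p + 1), Function.update b i (Nat.sqrt p + 1),
      ?_, ?_, ?_, ?_, ?_⟩
    · intro k
      by_cases h : k = i
      · subst h; simp
      · simpa [h] using ha k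
    · intro k
      by_cases h : k = i
      · subst h; simp
      · simpa [h] using hb k
    · intro k hk
      by_cases h : k = i
      · subst h
        simpa using (Nat.lt_succ_sqrt p).le
      · simpa [h] using hab k (Finset.mem_erase.2 ⟨h, hk⟩)
    · rw [hprod _ a hi1.1, hpa, h, pow_one, mul_comm]
      apply le_of_eq
      congr 2
      omega
    · rw [hprod _ b hi1.2, hpb, h, pow_one, mul_comm]
      apply le_of_eq
      congr 2
      omega

/-- Bound on the total number of operations, for exponents of at most `m` digits. -/
def totalCost {r : ℕ} (p m : ℕ) (n : Fin r → ℕ) : ℕ :=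
  ∑ i, expCost p (n i) + 2 * (Nat.log 2 p + 1) * m +
    ∑ j ∈ Finset.range m, stepCost p (Finset.univ.filter fun i => j < n i).card

/-- Chains for several bases run side by side, ordered by exponent: summands are positive, hence
smaller than their sum. -/
theorem RelChain.win {Ω G : Type*} [Group G] {S : Set Ω} {L : List (Ω → G)} {T : ℕ}
    {ι : Type*} (I : Finset ι) (F : ι → Finset ℕ) (B : ι → Set ℕ) (hF : ∀ i ∈ I, RelChain (B i) (F i))
    (f : ι → Ω → G) (hB : ∀ i ∈ I, ∀ e ∈ B i, (fun x => f i x ^ e) ∈ L)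
    (hW : ∀ L', L ⊆ L' → (∀ i ∈ I, ∀ e ∈ F i, (fun x => f i x ^ e) ∈ L') → Win L' S T) :
    Win L S (T + ∑ i ∈ I, (F i).card) := by
  rw [← Finset.card_sigma]
  refine Win.compute (fun t : (_ : ι) × ℕ => fun x => f t.1 x ^ t.2) (fun t => t.2) _ (I.sigma F) L
    rfl ?_ ?_
  · rintro ⟨i, e⟩ ht
    obtain ⟨hi, he⟩ := Finset.mem_sigma.1 ht
    obtain ⟨a, b, ha, hb, ha0, hb0, hab⟩ := hF i hi e he
    have key : ∀ a, (a ∈ B i ∨ a ∈ F i) → a < e → ((fun x => f i x ^ a) ∈ L ∨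
        ∃ t' ∈ I.sigma F, t'.2 < e ∧ (fun x => f i x ^ a) = fun x => f t'.1 x ^ t'.2) := by
      rintro a (ha | ha) hlt
      · exact Or.inl (hB i hi a ha)
      · exact Or.inr ⟨⟨i, a⟩, Finset.mem_sigma.2 ⟨hi, ha⟩, hlt, rfl⟩
    refine ⟨_, _, key a ha (by omega), key b hb (by omega), fun x _ => ?_⟩
    rw [← pow_add, hab]
  · intro L' hL h
    exact hW L' hL fun i hi e he => h ⟨i, e⟩ (Finset.mem_sigma.2 ⟨hi, he⟩)

/-! ### Finding the digits from the lowest upwards -/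

section Main

variable {G : Type*} [CommGroup G] {r p : ℕ} {n : Fin r → ℕ} {α : Fin r → G}

theorem pow_order_eq_one (hker : ∀ a b : Fin r → ℕ, ∏ i, α i ^ a i = ∏ i, α i ^ b i ↔
    ∀ i, a i ≡ b i [MOD p ^ n i]) (i : Fin r) : α i ^ p ^ n i = 1 := by
  have h := (hker (fun k => if k = i then p ^ n i else 0) (fun _ => 0)).2 fun k => by
    split_ifs with h
    · subst h
      exact (Nat.modEq_zero_iff_dvd).2 dvd_rfl
    · rfl
  rw [Finset.prod_eq_single i] at h
  · simpa using h
  · intro k _ hk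
    simp [hk]
  · simp

/-- The induction on j runs against time: at j = m nothing is known, at j = 0 everything. The budget
subtracts the exponents computed so far, so a step pays only for S i j \ S i (j + 1). By `hdep` the
digit found in the step does not change S i j. -/
theorem win_digits (hp : 0 < p)
    (hker : ∀ a b : Fin r → ℕ, ∏ i, α i ^ a i = ∏ i, α i ^ b i ↔ ∀ i, a i ≡ b i [MOD p ^ n i])
    {S : Fin r → ℕ → ℕ → Finset ℕ}
    (hdep : ∀ i j x x', x % p ^ (n i - 1 - j) = x' % p ^ (n i - 1 - j) → S i j x = S i j x')
    (hanti : ∀ i j x, S i (j + 1) x ⊆ S i j x)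
    (hchain : ∀ i j x, RelChain {0, 1} (S i j x))
    (hmem : ∀ i j x, p ^ j * (x % p ^ (n i - 1 - j)) ∈ ({0, 1} : Set ℕ) ∪ S i j x)
    (hgen : ∀ i j x, p ^ (n i - 1) ∈ ({0, 1} : Set ℕ) ∪ S i j x)
    (hcard : ∀ i j x, (S i j x).card ≤ expCost p (n i)) (m : ℕ) (j : ℕ) (hj : j ≤ m) :
    ∀ (z : Fin r → ℕ) (L : List ((Fin r → ℕ) → G)), (fun _ => 1) ∈ L → (∀ i, (fun _ => α i) ∈ L) →
      (∀ a < m, (fun x => (∏ i, α i ^ x i) ^ p ^ a) ∈ L) →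
      (∀ i, ∀ e ∈ S i j (z i), (fun _ => α i ^ e) ∈ L) →
      Win L {x | (∀ i, x i < p ^ n i) ∧ ∀ i, x i ≡ z i [MOD p ^ (n i - j)]}
        (∑ i, (expCost p (n i) - (S i j (z i)).card) +
          ∑ k ∈ Finset.range j, stepCost p (Finset.univ.filter fun i => k < n i).card) := by
  classical
  induction j with
  | zero =>
    intro z L _ _ _ _
    refine Win.done _ _ _ ?_
    rintro x ⟨hx, hxz⟩ y ⟨hy, hyz⟩
    funext i
    exact ((hxz i).trans (hyz i).symm).eq_of_lt_of_lt (hx i) (hy i)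
  | succ j ih =>
    intro z L h1 hα hβ hS
    set R := Finset.univ.filter fun i => j < n i with hR
    obtain ⟨a, b, ha, hb, hab, hpa, hpb⟩ := exists_balanced hp R
    set T := ∑ i, (expCost p (n i) - (S i j (z i)).card) +
          ∑ k ∈ Finset.range j, stepCost p (Finset.univ.filter fun i => k < n i).card with hT
    -- The two terms `R.card` are the giant strides and the product over R; the two ones are an
    -- inversion and a multiplication.
    have hcost : T + ∏ i, b i + R.card + ∏ i, a i + 1 + 1 + R.card +
        ∑ i, (S i j (z i) \ S i (j + 1) (z i)).card ≤
        ∑ i, (expCost p (n i) - (S i (j + 1) (z i)).card) +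
          ∑ k ∈ Finset.range (j + 1), stepCost p (Finset.univ.filter fun i => k < n i).card := by
      have : ∑ i, (expCost p (n i) - (S i (j + 1) (z i)).card) =
          ∑ i, (expCost p (n i) - (S i j (z i)).card) +
            ∑ i, (S i j (z i) \ S i (j + 1) (z i)).card := by
        rw [← Finset.sum_add_distrib]
        refine Finset.sum_congr rfl fun i _ => ?_
        have h1 := Finset.card_sdiff_add_card_eq_card (hanti i j (z i))
        have h2 := hcard i j (z i)
        omega
      rw [Finset.sum_range_succ, this, stepCost, hT, ← hR]
      omega
    refine Win.mono ?_ (List.Subset.refl _) (subset_refl _) hcost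
    refine RelChain.win Finset.univ (fun i => S i j (z i) \ S i (j + 1) (z i))
      (fun i => {0, 1} ∪ S i (j + 1) (z i)) (fun i _ => ?_) (fun i _ => α i) ?_ ?_
    · intro e he
      obtain ⟨a, b, ha, hb, hab⟩ := hchain i j (z i) e (Finset.mem_sdiff.1 he).1
      have key : ∀ a, (a ∈ ({0, 1} : Set ℕ) ∨ a ∈ S i j (z i)) →
          (a ∈ ({0, 1} : Set ℕ) ∪ S i (j + 1) (z i) ∨ a ∈ S i j (z i) \ S i (j + 1) (z i)) := by
        rintro a (ha | ha)
        · exact Or.inl (Or.inl ha)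
        · by_cases h : a ∈ S i (j + 1) (z i)
          · exact Or.inl (Or.inr h)
          · exact Or.inr (Finset.mem_sdiff.2 ⟨ha, h⟩)
      exact ⟨a, b, key a ha, key b hb, hab⟩
    · rintro i - e ((rfl | rfl) | he)
      · simpa using h1
      · simpa using hα i
      · exact hS i e he
    intro L₁ hL₁ hSL
    have hSj : ∀ i, ∀ e ∈ ({0, 1} : Set ℕ) ∪ S i j (z i), (fun _ => α i ^ e) ∈ L₁ := by
      rintro i e ((rfl | rfl) | he)
      · simpa using hL₁ h1
      · simpa using hL₁ (hα i)
      · by_cases h : e ∈ S i (j + 1) (z i)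
        · exact hL₁ (hS i e h)
        · exact hSL i (Finset.mem_univ i) e (Finset.mem_sdiff.2 ⟨he, h⟩)
    set y : Fin r → ℕ := fun i => z i % p ^ (n i - 1 - j) with hy
    refine Win.prod R (fun i _ => α i ^ (p ^ j * y i)) (hL₁ h1) (fun i _ => hSj i _ (hmem i j (z i)))
      fun L₂ hL₂ hP => ?_
    refine Win.invStep (fun _ => (∏ i ∈ R, α i ^ (p ^ j * y i))⁻¹) hP (fun _ _ => rfl)
      fun L₃ hL₃ hP' => ?_
    -- This equals ∏ e i ^ (x i / p^(n i - 1 - j)): the power p^j kills the factors with n i ≤ j,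
    -- and the known lower digits cancel in the others.
    refine Win.mulStep (fun x => (∏ i, α i ^ x i) ^ p ^ j * (∏ i ∈ R, α i ^ (p ^ j * y i))⁻¹)
      (hL₃ (hL₂ (hL₁ (hβ j hj)))) hP' (fun _ _ => rfl) fun L₄ hL₄ hγ => ?_
    have hL14 : L₁ ⊆ L₄ := List.Subset.trans hL₂ (List.Subset.trans hL₃ hL₄)
    have hL04 : L ⊆ L₄ := List.Subset.trans hL₁ hL14
    set e : Fin r → G := fun i => if j < n i then α i ^ p ^ (n i - 1) else 1 with he
    have hone : ∀ i, α i ^ p ^ n i = 1 := pow_order_eq_one hker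
    have hxy : ∀ x : Fin r → ℕ, (∀ i, x i ≡ z i [MOD p ^ (n i - (j + 1))]) → ∀ i,
        x i = y i + p ^ (n i - 1 - j) * (x i / p ^ (n i - 1 - j)) := by
      intro x hx i
      have h := hx i
      rw [Nat.add_comm j, ← Nat.sub_sub] at h
      simp only [hy]
      rw [← h, Nat.mod_add_div]
    refine Win.babyGiant hp e ?_ R ?_ a b ha hb hab (fun x i => x i / p ^ (n i - 1 - j))
      (fun x => (∏ i, α i ^ x i) ^ p ^ j * (∏ i ∈ R, α i ^ (p ^ j * y i))⁻¹) ?_ (hL04 h1) ?_ hγ ?_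
    · intro i
      simp only [he]
      split_ifs with h
      · rw [← pow_mul, ← pow_succ, Nat.sub_add_cancel (by omega), hone]
      · exact one_pow p
    · intro i hi
      have : ¬ j < n i := by simpa [hR] using hi
      simp [he, this]
    · rintro x ⟨-, hx⟩
      rw [mul_inv_eq_iff_eq_mul, ← Finset.prod_pow, hR, Finset.prod_filter,
        ← Finset.prod_mul_distrib]
      refine Finset.prod_congr rfl fun i _ => ?_
      simp only [he]
      split_ifs with h
      · rw [← pow_mul, ← pow_mul, ← pow_add]
        congr 1
        conv_lhs => rw [hxy x hx i]
        have : p ^ (n i - 1) = p ^ j * p ^ (n i - 1 - j) := by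
          rw [← pow_add]; congr 1; omega
        rw [this]
        ring
      · rw [one_pow, one_mul, ← pow_mul, mul_comm, pow_mul,
          orderOf_dvd_iff_pow_eq_one.1 ((orderOf_dvd_of_pow_eq_one (hone i)).trans
            (pow_dvd_pow p (not_lt.1 h))), one_pow]
    · intro i
      simp only [he]
      split_ifs with h
      · exact hL14 (hSj i _ (hgen i j (z i)))
      · exact hL04 h1
    · intro L₅ hL₅ D
      have hL05 : L ⊆ L₅ := List.Subset.trans hL04 hL₅
      -- For n i ≤ j the modulus is p^0, so z i may stay as it is.
      set z' : Fin r → ℕ := fun i => if j < n i then y i + p ^ (n i - 1 - j) * D i else z i with hz'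
      have hSz : ∀ i, S i j (z' i) = S i j (z i) := by
        intro i
        apply hdep
        simp only [hz']
        split_ifs with h
        · rw [Nat.add_mul_mod_self_left, hy, Nat.mod_mod]
        · rfl
      have hW := ih (by omega) z' L₅ (hL05 h1) (fun i => hL05 (hα i)) (fun a ha => hL05 (hβ a ha))
        (fun i e he => by
          rw [hSz i] at he
          exact hL₅ (hL14 (hSj i e (Or.inr he))))
      simp only [hSz] at hW
      refine hW.mono (List.Subset.refl _) ?_ le_rfl
      rintro x ⟨⟨hx, hxz⟩, h⟩
      refine ⟨hx, fun i => ?_⟩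
      have hconv : ∀ d : Fin r → ℕ, ∏ i, e i ^ d i =
          ∏ i, α i ^ (if j < n i then p ^ (n i - 1) * d i else 0) := by
        intro d
        refine Finset.prod_congr rfl fun i _ => ?_
        simp only [he]
        split_ifs with h
        · rw [pow_mul]
        · simp
      rw [hconv, hconv, hker] at h
      have hi := h i
      simp only [hz']
      split_ifs at hi ⊢ with hji
      · have e1 : p ^ n i = p ^ (n i - 1) * p := by
          rw [← pow_succ, Nat.sub_add_cancel (by omega)]
        rw [e1] at hi
        have h2 := Nat.ModEq.mul_left_cancel' (by positivity) hi
        have e2 : p ^ (n i - j) = p ^ (n i - 1 - j) * p := by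
          rw [← pow_succ]; congr 1; omega
        rw [e2]
        conv_lhs => rw [hxy x hxz i]
        exact (h2.mul_left' _).add_left _
      · have : n i - j = 0 := by omega
        rw [this, pow_zero]
        exact Nat.modEq_one

/-- The sets S i m x have modulus p^0 and do not depend on x, so they are computed in advance for x
= 0, along with the powers β^(p^a). -/
theorem win_discreteLog (hp : 0 < p)
    (hker : ∀ a b : Fin r → ℕ, ∏ i, α i ^ a i = ∏ i, α i ^ b i ↔ ∀ i, a i ≡ b i [MOD p ^ n i])
    (m : ℕ) (hm : ∀ i, n i ≤ m) (L : List ((Fin r → ℕ) → G)) (h1 : (fun _ => 1) ∈ L)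
    (hα : ∀ i, (fun _ => α i) ∈ L) (hβ : (fun x => ∏ i, α i ^ x i) ∈ L) :
    Win L {x | ∀ i, x i < p ^ n i} (totalCost p m n) := by
  choose S hdep hanti hchain hmem hgen hcard using fun i => exists_online_chain p (n i) hp
  obtain ⟨F, hF, hFc, hFm⟩ := reach_pow_mul (B := {0, 1}) (by simp) (g := 1) (by simp)
    (Nat.lt_pow_succ_log_self (by norm_num : 1 < 2) p) m
  have hcost : ∑ i, (expCost p (n i) - (S i m 0).card) +
      ∑ k ∈ Finset.range m, stepCost p (Finset.univ.filter fun i => k < n i).card +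
      ∑ i, (S i m 0).card + ∑ _i : Unit, F.card ≤ totalCost p m n := by
    have : ∑ i, expCost p (n i) =
        ∑ i, (expCost p (n i) - (S i m 0).card) + ∑ i, (S i m 0).card := by
      rw [← Finset.sum_add_distrib]
      refine Finset.sum_congr rfl fun i _ => ?_
      have := hcard i m 0
      omega
    rw [totalCost, this]
    rw [Nat.succ_eq_add_one] at hF
    simp only [Finset.univ_unique, Finset.sum_singleton]
    omega
  refine Win.mono ?_ (List.Subset.refl _) (subset_refl _) hcost
  refine RelChain.win Finset.univ (fun _ => F) (fun _ => {0, 1}) (fun _ _ => hFc)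
    (fun _ x => ∏ i, α i ^ x i) ?_ fun L₁ hL₁ hFL => ?_
  · rintro - - e (rfl | rfl)
    · simpa using h1
    · simpa using hβ
  refine RelChain.win Finset.univ (fun i => S i m 0) (fun _ => {0, 1}) (fun i _ => hchain i m 0)
    (fun i _ => α i) ?_ fun L₂ hL₂ hSL => ?_
  · rintro i - e (rfl | rfl)
    · simpa using hL₁ h1
    · simpa using hL₁ (hα i)
  have hL : L ⊆ L₂ := List.Subset.trans hL₁ hL₂
  refine (win_digits hp hker hdep hanti hchain hmem hgen hcard m m le_rfl (fun _ => 0) L₂ (hL h1)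
    (fun i => hL (hα i)) (fun a ha => ?_) (fun i e he => hSL i (Finset.mem_univ i) e he)).mono
    (List.Subset.refl _) ?_ le_rfl
  · have hmem := hFm ⟨a, ha.le, rfl⟩
    rw [mul_one] at hmem
    rcases hmem with (h | h) | h
    · rw [h]; simpa using hL h1
    · rw [Set.mem_singleton_iff.1 h]; simpa using hL hβ
    · exact hL₂ (hFL () (Finset.mem_univ _) _ h)
  · intro x hx
    refine ⟨hx, fun i => ?_⟩
    rw [Nat.sub_eq_zero_of_le (hm i), pow_zero]
    exact Nat.modEq_one

end Main

/-! ### Strategies depending on the pattern of equalities -/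

/-- The list that has at each position the first position with the same entry. -/
def eqPattern {M : Type*} [DecidableEq M] (L : List M) : List ℕ := L.map fun a => L.idxOf a

theorem idxOf_map_of_injOn {M N : Type*} [DecidableEq M] [DecidableEq N] (f : M → N) (a : M) :
    ∀ L : List M, (∀ b ∈ L, f b = f a → b = a) → (L.map f).idxOf (f a) = L.idxOf a
  | [], _ => rfl
  | b :: L, h => by
    rw [List.map_cons, List.idxOf_cons, List.idxOf_cons,
      idxOf_map_of_injOn f a L fun c hc => h c (List.mem_cons_of_mem _ hc)]
    by_cases hb : b = a
    · simp [hb]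
    · have : f b ≠ f a := fun h' => hb (h b List.mem_cons_self h')
      simp [beq_eq_false_iff_ne.2 hb, beq_eq_false_iff_ne.2 this]

theorem eqPattern_map {M N : Type*} [DecidableEq M] [DecidableEq N] (f : M → N) (L : List M)
    (hf : ∀ a ∈ L, ∀ b ∈ L, f a = f b → a = b) : eqPattern (L.map f) = eqPattern L := by
  rw [eqPattern, eqPattern, List.map_map]
  refine List.map_congr_left fun a ha => ?_
  exact idxOf_map_of_injOn f a L fun b hb => hf b hb a ha

theorem length_eqPattern {M : Type*} [DecidableEq M] (L : List M) :
    (eqPattern L).length = L.length := by simp [eqPattern]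

theorem eqPattern_getElem?_eq_iff {M : Type*} [DecidableEq M] {L : List M} {i j : ℕ} {a b : M}
    (ha : L[i]? = some a) (hb : L[j]? = some b) :
    (eqPattern L)[i]? = (eqPattern L)[j]? ↔ a = b := by
  simp only [eqPattern, List.getElem?_map, ha, hb, Option.map_some, Option.some_inj]
  exact List.idxOf_inj (List.mem_of_getElem? ha)

/-- Run of a strategy that chooses the next instruction from the pattern of equalities among the
elements received so far. -/
inductive RunBy (s : List ℕ → Instr) {G : Type*} [Group G] [DecidableEq G] :
    List G → ℕ → List ℕ → Prop
  | halt (L : List G) (out : List ℕ) (h : s (eqPattern L) = Instr.halt out) : RunBy s L 0 out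
  | step (L : List G) (g : G) (k : ℕ) (out : List ℕ) (h : (s (eqPattern L)).exec L = some g)
      (hrun : RunBy s (L ++ [g]) k out) : RunBy s L (k + 1) out

theorem RunBy.congr {s s' : List ℕ → Instr} {G : Type*} [Group G] [DecidableEq G] {L : List G}
    {k : ℕ} {out : List ℕ} (h : RunBy s L k out)
    (hs : ∀ L', L <+: L' → s (eqPattern L') = s' (eqPattern L')) : RunBy s' L k out := by
  induction h with
  | halt L out h => exact .halt _ _ (by rw [← hs L (List.prefix_refl L), h])
  | step L g k out h hrun ih =>
    exact .step _ g _ _ (by rw [← hs L (List.prefix_refl L), h])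
      (ih fun L' hL' => hs L' ((List.prefix_append L [g]).trans hL'))

/-- The length of the pattern tells which operation is due, and its entries tell the outcome of
every test. -/
theorem Win.exists_strategy {Ω G : Type*} [Group G] [DecidableEq G] (out : Ω → List ℕ)
    {L : List (Ω → G)} {S : Set Ω} {T : ℕ} (h : Win L S T) :
    ∃ s : List ℕ → Instr, ∀ x ∈ S, ∃ k ≤ T, RunBy s (L.map fun f => f x) k (out x) := by
  have hget : ∀ {L : List (Ω → G)} {i : ℕ} {e : Ω → G} (x : Ω), L[i]? = some e →
      (L.map fun f => f x)[i]? = some (e x) := fun x h => by simp [h]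
  have happ : ∀ (L : List (Ω → G)) (f : Ω → G) (x : Ω),
      ((L ++ [f]).map fun f => f x) = (L.map fun f => f x) ++ [f x] := fun L f x => by simp
  have hop : ∀ (L : List (Ω → G)) (S : Set Ω) (T : ℕ) (f : Ω → G) (ins : Instr),
      (∀ x ∈ S, ins.exec (L.map fun f => f x) = some (f x)) →
      (∃ s : List ℕ → Instr, ∀ x ∈ S, ∃ k ≤ T,
        RunBy s ((L ++ [f]).map fun f => f x) k (out x)) →
      ∃ s : List ℕ → Instr, ∀ x ∈ S, ∃ k ≤ T + 1, RunBy s (L.map fun f => f x) k (out x) := by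
    rintro L S T f ins hins ⟨s, hs⟩
    refine ⟨fun q => if q.length ≤ L.length then ins else s q, fun x hx => ?_⟩
    obtain ⟨k, hk, hrun⟩ := hs x hx
    refine ⟨k + 1, by omega, .step _ (f x) _ _ ?_ ?_⟩
    · rw [if_pos (by simp [length_eqPattern]), hins x hx]
    · rw [happ] at hrun
      refine hrun.congr fun L' hL' => ?_
      have := hL'.length_le
      rw [if_neg]
      simp at this
      simp [length_eqPattern]
      omega
  induction h with
  | done L S T h =>
    rcases S.eq_empty_or_nonempty with rfl | ⟨x₀, hx₀⟩
    · exact ⟨fun _ => .halt [], by simp⟩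
    · refine ⟨fun _ => .halt (out x₀), fun x hx => ⟨0, Nat.zero_le _, ?_⟩⟩
      rw [h hx hx₀]
      exact .halt _ _ rfl
  | mul L S T f e e' he he' hf h ih =>
    obtain ⟨i, hi⟩ := List.getElem?_of_mem he
    obtain ⟨j, hj⟩ := List.getElem?_of_mem he'
    refine hop L S T f (.mul i j) (fun x hx => ?_) ih
    rw [Instr.exec, hget x hi, hget x hj, hf x hx]
    rfl
  | inv L S T f e he hf h ih =>
    obtain ⟨i, hi⟩ := List.getElem?_of_mem he
    refine hop L S T f (.inv i) (fun x hx => ?_) ih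
    rw [Instr.exec, hget x hi, hf x hx]
    rfl
  | split L S T e e' he he' h h' ih ih' =>
    obtain ⟨i, hi⟩ := List.getElem?_of_mem he
    obtain ⟨j, hj⟩ := List.getElem?_of_mem he'
    obtain ⟨s, hs⟩ := ih
    obtain ⟨s', hs'⟩ := ih'
    -- Appending elements leaves earlier entries of the pattern unchanged, so a test can be read off
    -- again at any later time.
    have hpat : ∀ x L', (L.map fun f => f x) <+: L' →
        ((eqPattern L')[i]? = (eqPattern L')[j]? ↔ e x = e' x) := by
      rintro x - ⟨t, rfl⟩
      refine eqPattern_getElem?_eq_iff ?_ ?_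
      · rw [List.getElem?_append_left ?_, hget x hi]
        rw [List.length_map]; exact (List.getElem?_eq_some_iff.1 hi).1
      · rw [List.getElem?_append_left ?_, hget x hj]
        rw [List.length_map]; exact (List.getElem?_eq_some_iff.1 hj).1
    refine ⟨fun q => if q[i]? = q[j]? then s q else s' q, fun x hx => ?_⟩
    by_cases hxe : e x = e' x
    · obtain ⟨k, hk, hrun⟩ := hs x ⟨hx, hxe⟩
      refine ⟨k, hk, hrun.congr fun L' hL' => ?_⟩
      rw [if_pos ((hpat x L' hL').2 hxe)]
    · obtain ⟨k, hk, hrun⟩ := hs' x ⟨hx, hxe⟩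
      refine ⟨k, hk, hrun.congr fun L' hL' => ?_⟩
      rw [if_neg fun h => hxe ((hpat x L' hL').1 h)]

/-- `Instr.exec` for arbitrary operations. -/
def Instr.execWith {M : Type*} (mul : M → M → M) (inv : M → M) (L : List M) : Instr → Option M
  | .mul a b => L[a]?.bind fun g => L[b]?.map fun h => mul g h
  | .inv a => L[a]?.map inv
  | .halt _ => none

/-- One step of the simulation of a strategy. -/
def simStep {M : Type*} [DecidableEq M] (mul : M → M → M) (inv : M → M) (s : List ℕ → Instr)
    (L : List M) : List M :=
  L ++ ((s (eqPattern L)).execWith mul inv L).toList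

theorem exec_eq_execWith {G : Type*} [Group G] (L : List G) (i : Instr) :
    i.exec L = i.execWith (· * ·) (·⁻¹) L := by
  cases i <;> rfl

theorem iterate_simStep_of_none {M : Type*} [DecidableEq M] {mul : M → M → M} {inv : M → M}
    {s : List ℕ → Instr} {L : List M} (h : (s (eqPattern L)).execWith mul inv L = none) (t : ℕ) :
    (simStep mul inv s)^[t] L = L :=
  Function.iterate_fixed (by simp [simStep, h]) t

theorem RunBy.iterate {s : List ℕ → Instr} {G : Type*} [Group G] [DecidableEq G] {L : List G}
    {k : ℕ} {out : List ℕ} (h : RunBy s L k out) : ∀ B, k ≤ B →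
      s (eqPattern ((simStep (· * ·) (·⁻¹) s)^[B] L)) = .halt out := by
  induction h with
  | halt L out h =>
    intro B _
    rw [iterate_simStep_of_none (by rw [h]; rfl), h]
  | step L g k out h hrun ih =>
    intro B hB
    obtain ⟨B, rfl⟩ : ∃ B', B = B' + 1 := ⟨B - 1, by omega⟩
    rw [Function.iterate_succ_apply, simStep, ← exec_eq_execWith, h]
    exact ih B (by omega)

/-- An instruction without result leaves the list fixed, so the halting instruction seen after B
steps is the one at which the run itself stops. -/
theorem exists_run_of_iterate (A : GenericAlgorithm) {G : Type*} [Group G] [DecidableEq G]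
    (label : G → ℕ) (input : ℕ × List ℕ) (s : List ℕ → Instr)
    (hA : ∀ L : List G, A.next (input, L.map label) = s (eqPattern L)) (out : List ℕ) (B : ℕ) :
    ∀ L : List G, s (eqPattern ((simStep (· * ·) (·⁻¹) s)^[B] L)) = .halt out →
      ∃ T ≤ B, A.Run label input L T out := by
  induction B with
  | zero => exact fun L h => ⟨0, le_rfl, .halt _ _ (by rw [hA]; exact h)⟩
  | succ B ih =>
    intro L h
    cases hg : (s (eqPattern L)).execWith (· * ·) (·⁻¹) L with
    | none =>
      rw [iterate_simStep_of_none hg] at h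
      exact ⟨0, Nat.zero_le _, .halt _ _ (by rw [hA]; exact h)⟩
    | some g =>
      rw [Function.iterate_succ_apply, simStep, hg] at h
      obtain ⟨T, hT, hrun⟩ := ih _ h
      exact ⟨T + 1, by omega, .step _ g _ _ (by rw [hA, exec_eq_execWith, hg]) hrun⟩

/-- Instructions name positions and are chosen by the equality pattern; neither changes under φ.
Restricting to `good` elements admits residue lists, on which φ is injective only when they are
reduced. -/
theorem simStep_map {M N : Type*} [DecidableEq M] [DecidableEq N] {mul : M → M → M} {inv : M → M}
    {mul' : N → N → N} {inv' : N → N} (s : List ℕ → Instr) (φ : M → N) (good : M → Prop)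
    (hmul : ∀ a b, good a → good b → good (mul a b) ∧ φ (mul a b) = mul' (φ a) (φ b))
    (hinv : ∀ a, good a → good (inv a) ∧ φ (inv a) = inv' (φ a))
    (hinj : ∀ a b, good a → good b → φ a = φ b → a = b) (L : List M) (hL : ∀ a ∈ L, good a) :
    (∀ a ∈ simStep mul inv s L, good a) ∧
      simStep mul' inv' s (L.map φ) = (simStep mul inv s L).map φ := by
  have hpat : eqPattern (L.map φ) = eqPattern L :=
    eqPattern_map φ L fun a ha b hb => hinj a b (hL a ha) (hL b hb)
  have hmem : ∀ {i : ℕ} {a}, L[i]? = some a → good a := fun h => hL _ (List.mem_of_getElem? h)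
  rw [simStep, simStep, hpat]
  cases s (eqPattern L) with
  | mul a b =>
    simp only [Instr.execWith, List.getElem?_map]
    cases ha : L[a]? with
    | none => simpa using hL
    | some g =>
      cases hb : L[b]? with
      | none => simpa using hL
      | some h =>
        have := hmul g h (hmem ha) (hmem hb)
        simp only [Option.map_some, Option.bind_some, Option.toList_some, List.map_append,
          List.map_cons, List.map_nil, this.2, and_true]
        intro c hc
        rcases List.mem_append.1 hc with hc | hc
        · exact hL c hc
        · rw [List.mem_singleton.1 hc]; exact this.1
  | inv a =>
    simp only [Instr.execWith, List.getElem?_map]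
    cases ha : L[a]? with
    | none => simpa using hL
    | some g =>
      have := hinv g (hmem ha)
      simp only [Option.map_some, Option.toList_some, List.map_append,
        List.map_cons, List.map_nil, this.2, and_true]
      intro c hc
      rcases List.mem_append.1 hc with hc | hc
      · exact hL c hc
      · rw [List.mem_singleton.1 hc]; exact this.1
  | halt out => simpa [Instr.execWith] using hL

theorem iterate_simStep_map {M N : Type*} [DecidableEq M] [DecidableEq N] {mul : M → M → M}
    {inv : M → M} {mul' : N → N → N} {inv' : N → N} (s : List ℕ → Instr) (φ : M → N)
    (good : M → Prop)
    (hmul : ∀ a b, good a → good b → good (mul a b) ∧ φ (mul a b) = mul' (φ a) (φ b))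
    (hinv : ∀ a, good a → good (inv a) ∧ φ (inv a) = inv' (φ a))
    (hinj : ∀ a b, good a → good b → φ a = φ b → a = b) (L : List M) (hL : ∀ a ∈ L, good a)
    (t : ℕ) :
    eqPattern ((simStep mul' inv' s)^[t] (L.map φ)) = eqPattern ((simStep mul inv s)^[t] L) := by
  induction t generalizing L with
  | zero => exact eqPattern_map φ L fun a ha b hb => hinj a b (hL a ha) (hL b hb)
  | succ t ih =>
    have h := simStep_map (mul' := mul') (inv' := inv') s φ good hmul hinv hinj L hL
    rw [Function.iterate_succ_apply, Function.iterate_succ_apply, h.2, ih _ h.1]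

/-- The strategy given by a finite table; the argument is looked up at the position of its code. -/
def tableStrategy (σ : List Instr) (q : List ℕ) : Instr :=
  (σ[Encodable.encode q]?).getD (.halt [])

/-- On finitely many patterns a strategy is a finite object, which a search can find. -/
theorem exists_tableStrategy (s : List ℕ → Instr) (Q : Finset (List ℕ)) :
    ∃ σ, ∀ q ∈ Q, tableStrategy σ q = s q := by
  refine ⟨(List.range (Q.sup Encodable.encode + 1)).map fun k =>
    ((Encodable.decode k : Option (List ℕ)).map s).getD (.halt []), fun q hq => ?_⟩
  have : Encodable.encode q < Q.sup Encodable.encode + 1 :=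
    Nat.lt_succ_of_le (Finset.le_sup (f := Encodable.encode) hq)
  simp [tableStrategy, this]

/-! ### Residue vectors as a model of a group with a basis -/

/-- Sum of residue vectors. -/
def vecAdd (p : ℕ) (n : List ℕ) (a b : List ℕ) : List ℕ :=
  (List.range n.length).map fun i => (a.getD i 0 + b.getD i 0) % p ^ n.getD i 0

/-- Negative of a residue vector. -/
def vecNeg (p : ℕ) (n : List ℕ) (a : List ℕ) : List ℕ :=
  (List.range n.length).map fun i => (p ^ n.getD i 0 - a.getD i 0) % p ^ n.getD i 0

/-- Unit vectors; the zero vector for `k ≥ n.length`. -/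
def vecUnit (p : ℕ) (n : List ℕ) (k : ℕ) : List ℕ :=
  (List.range n.length).map fun i => (if i = k then 1 else 0) % p ^ n.getD i 0

/-- The elements given in the beginning, in the model, where `y` is the discrete logarithm. -/
def vecInit (p : ℕ) (n : List ℕ) (y : List ℕ) : List (List ℕ) :=
  [vecUnit p n n.length] ++ (List.range n.length).map (vecUnit p n) ++ [y]

/-- All residue vectors. -/
def vecBox (p : ℕ) (n : List ℕ) : List (List ℕ) :=
  n.foldr (fun k B => (List.range (p ^ k)).flatMap fun a => B.map (a :: ·)) [[]]

theorem mem_vecBox_ofFn {p r : ℕ} (n x : Fin r → ℕ) :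
    List.ofFn x ∈ vecBox p (List.ofFn n) ↔ ∀ i, x i < p ^ n i := by
  induction r with
  | zero => simp [vecBox]
  | succ r ih =>
    have h := ih (fun i => n i.succ) (fun i => x i.succ)
    rw [vecBox] at h
    rw [List.ofFn_succ, List.ofFn_succ, vecBox, List.foldr_cons, Fin.forall_fin_succ, ← h]
    simp

theorem exists_ofFn_of_mem_vecBox {p : ℕ} {r : ℕ} (n : Fin r → ℕ) {y : List ℕ}
    (hy : y ∈ vecBox p (List.ofFn n)) :
    ∃ x : Fin r → ℕ, y = List.ofFn x ∧ ∀ i, x i < p ^ n i := by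
  have hlen : ∀ l : List ℕ, ∀ y ∈ vecBox p l, y.length = l.length := by
    intro l
    induction l with
    | nil => simp [vecBox]
    | cons k l ih =>
      intro y hy
      simp only [vecBox, List.foldr_cons, List.mem_flatMap, List.mem_map] at hy
      obtain ⟨a, -, z, hz, rfl⟩ := hy
      simp [ih z hz]
  have h1 : y.length = r := by simpa using hlen _ y hy
  subst h1
  refine ⟨y.get, (List.ofFn_get y).symm, ?_⟩
  rw [← mem_vecBox_ofFn, List.ofFn_get]
  exact hy

section Model

variable {G : Type*} [CommGroup G] {r p : ℕ} {n : Fin r → ℕ} {α : Fin r → G}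

/-- The group element represented by a residue vector. -/
def vecEval (α : Fin r → G) (v : List ℕ) : G := ∏ i : Fin r, α i ^ v.getD i 0

/-- Reduced residue vectors. -/
def VecGood (p : ℕ) (n : Fin r → ℕ) (v : List ℕ) : Prop :=
  v.length = r ∧ ∀ i : Fin r, v.getD i 0 < p ^ n i

theorem getD_ofFn (x : Fin r → ℕ) (i : Fin r) : (List.ofFn x).getD i 0 = x i := by
  simp [List.getD]

theorem getD_map_range (f : ℕ → ℕ) (i : Fin r) : ((List.range r).map f).getD i 0 = f i := by
  simp [List.getD]

theorem vecGood_map_range (hp : 0 < p) (f : ℕ → ℕ) :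
    VecGood p n ((List.range (List.ofFn n).length).map fun i =>
      f i % p ^ (List.ofFn n).getD i 0) := by
  refine ⟨by simp, fun i => ?_⟩
  rw [List.length_ofFn, getD_map_range, getD_ofFn]
  exact Nat.mod_lt _ (by positivity)

variable (hker : ∀ a b : Fin r → ℕ, ∏ i, α i ^ a i = ∏ i, α i ^ b i ↔
  ∀ i, a i ≡ b i [MOD p ^ n i])

include hker

theorem vecEval_map_range (f : ℕ → ℕ) :
    vecEval α ((List.range (List.ofFn n).length).map fun i => f i % p ^ (List.ofFn n).getD i 0) =
      ∏ i : Fin r, α i ^ f i := by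
  refine (hker _ _).2 fun i => ?_
  rw [List.length_ofFn, getD_map_range, getD_ofFn]
  exact Nat.mod_modEq _ _

theorem vecEval_vecAdd (a b : List ℕ) :
    vecEval α (vecAdd p (List.ofFn n) a b) = vecEval α a * vecEval α b := by
  rw [vecAdd, vecEval_map_range hker, vecEval, vecEval, ← Finset.prod_mul_distrib]
  simp_rw [pow_add]

theorem vecEval_vecNeg {a : List ℕ} (ha : VecGood p n a) :
    vecEval α (vecNeg p (List.ofFn n) a) = (vecEval α a)⁻¹ := by
  rw [eq_inv_iff_mul_eq_one, vecNeg, vecEval_map_range hker, vecEval, ← Finset.prod_mul_distrib]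
  refine Finset.prod_eq_one fun i _ => ?_
  rw [← pow_add, getD_ofFn, Nat.sub_add_cancel (ha.2 i).le, pow_order_eq_one hker]

theorem vecEval_injOn {a b : List ℕ} (ha : VecGood p n a) (hb : VecGood p n b)
    (h : vecEval α a = vecEval α b) : a = b := by
  refine List.ext_getElem (ha.1.trans hb.1.symm) fun i hi hi' => ?_
  have hir : i < r := ha.1 ▸ hi
  have h1 := ((hker _ _).1 h ⟨i, hir⟩).eq_of_lt_of_lt (ha.2 _) (hb.2 _)
  simpa [List.getD, hi, hi'] using h1

theorem vecEval_vecUnit (k : Fin r) : vecEval α (vecUnit p (List.ofFn n) k) = α k := by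
  rw [vecUnit, vecEval_map_range hker, Finset.prod_eq_single k]
  · simp
  · intro i _ hi
    rw [if_neg (fun h => hi (Fin.ext h)), pow_zero]
  · simp

theorem vecEval_vecUnit_length :
    vecEval α (vecUnit p (List.ofFn n) (List.ofFn n).length) = 1 := by
  rw [vecUnit, vecEval_map_range hker]
  refine Finset.prod_eq_one fun i _ => ?_
  rw [if_neg (by rw [List.length_ofFn]; exact i.2.ne), pow_zero]

theorem map_vecInit (x : Fin r → ℕ) :
    (vecInit p (List.ofFn n) (List.ofFn x)).map (vecEval α) =
      [1] ++ List.ofFn α ++ [∏ i, α i ^ x i] := by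
  rw [vecInit, List.map_append, List.map_append, List.map_singleton, List.map_singleton,
    vecEval_vecUnit_length hker, List.map_map]
  congr 2
  · refine List.ext_getElem (by simp) fun i hi hi' => ?_
    have hir : i < r := by simpa using hi
    simpa using vecEval_vecUnit hker ⟨i, hir⟩
  · simp only [vecEval, getD_ofFn]

/-- On reduced vectors `vecEval` respects the operations and is injective. A table checked in the
model is therefore valid in every group with a basis of the same orders. -/
theorem eqPattern_iterate_model [DecidableEq G] (hp : 0 < p) (s : List ℕ → Instr) {x : Fin r → ℕ}
    (hx : ∀ i, x i < p ^ n i) (t : ℕ) :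
    eqPattern ((simStep (· * ·) (·⁻¹) s)^[t] ([1] ++ List.ofFn α ++ [∏ i, α i ^ x i])) =
      eqPattern ((simStep (vecAdd p (List.ofFn n)) (vecNeg p (List.ofFn n)) s)^[t]
        (vecInit p (List.ofFn n) (List.ofFn x))) := by
  rw [← map_vecInit hker]
  refine iterate_simStep_map s (vecEval α) (VecGood p n)
    (fun a b _ _ => ⟨vecGood_map_range hp _, vecEval_vecAdd hker a b⟩)
    (fun a ha => ⟨vecGood_map_range hp _, vecEval_vecNeg hker ha⟩)
    (fun a b ha hb => vecEval_injOn hker ha hb) _ ?_ t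
  intro a ha
  rw [vecInit, List.mem_append, List.mem_append, List.mem_singleton, List.mem_singleton] at ha
  rcases ha with (rfl | ha) | rfl
  · exact vecGood_map_range hp _
  · obtain ⟨k, -, rfl⟩ := List.mem_map.1 ha
    exact vecGood_map_range hp _
  · exact ⟨by simp, fun i => by rw [getD_ofFn]; exact hx i⟩

end Model

/-- A group with a basis with prescribed orders. -/
theorem exists_group_with_basis {r : ℕ} (p : ℕ) (n : Fin r → ℕ) :
    ∃ (G : Type) (_ : CommGroup G) (α : Fin r → G), ∀ a b : Fin r → ℕ,
      ∏ i, α i ^ a i = ∏ i, α i ^ b i ↔ ∀ i, a i ≡ b i [MOD p ^ n i] := by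
  classical
  refine ⟨Multiplicative ((i : Fin r) → ZMod (p ^ n i)), inferInstance,
    fun i => Multiplicative.ofAdd (Pi.single i 1), fun a b => ?_⟩
  have h : ∀ a : Fin r → ℕ,
      ∏ i, (Multiplicative.ofAdd (Pi.single i 1 : (i : Fin r) → ZMod (p ^ n i))) ^ a i =
        Multiplicative.ofAdd (fun i => (a i : ZMod (p ^ n i))) := by
    intro a
    simp_rw [← ofAdd_nsmul]
    rw [← ofAdd_sum]
    congr 1
    funext i
    rw [Finset.sum_apply, Finset.sum_eq_single i]
    · simp
    · intro k _ hk
      simp [Pi.single_eq_of_ne hk.symm]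
    · simp
  rw [h, h, EmbeddingLike.apply_eq_iff_eq, funext_iff]
  simp_rw [ZMod.natCast_eq_natCast_iff]

/-- Some table solves all instances in the model. -/
theorem exists_table {r p : ℕ} (hp : 0 < p) (n : Fin r → ℕ) (m : ℕ) (hm : ∀ i, n i ≤ m) :
    ∃ σ, ∀ y ∈ vecBox p (List.ofFn n),
      tableStrategy σ (eqPattern ((simStep (vecAdd p (List.ofFn n)) (vecNeg p (List.ofFn n))
        (tableStrategy σ))^[totalCost p m n] (vecInit p (List.ofFn n) y))) = .halt y := by
  classical
  obtain ⟨G, _, α, hker⟩ := exists_group_with_basis p n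
  set L₀ : List ((Fin r → ℕ) → G) :=
    [fun _ => 1] ++ List.ofFn (fun i _ => α i) ++ [fun x => ∏ i, α i ^ x i] with hL₀
  have hwin := win_discreteLog hp hker m hm L₀ (by simp [hL₀])
    (fun i => by
      refine List.mem_append_left _ (List.mem_append_right _ ?_)
      exact (List.mem_ofFn' _ _).2 ⟨i, rfl⟩)
    (by simp [hL₀])
  obtain ⟨s, hs⟩ := hwin.exists_strategy List.ofFn
  have hmap : ∀ x, (L₀.map fun f => f x) = [1] ++ List.ofFn α ++ [∏ i, α i ^ x i] := by
    intro x
    simp [hL₀, List.map_ofFn, Function.comp_def]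
  set B := totalCost p m n with hB
  set step := simStep (vecAdd p (List.ofFn n)) (vecNeg p (List.ofFn n)) with hstep
  -- These are all patterns met in the simulations; agreement with s on them fixes the whole
  -- simulation.
  set Q : Finset (List ℕ) := ((vecBox p (List.ofFn n)).toFinset ×ˢ Finset.range (B + 1)).image
    fun t => eqPattern ((step s)^[t.2] (vecInit p (List.ofFn n) t.1)) with hQ
  obtain ⟨σ, hσ⟩ := exists_tableStrategy s Q
  refine ⟨σ, fun y hy => ?_⟩
  have hmemQ : ∀ t ≤ B, eqPattern ((step s)^[t] (vecInit p (List.ofFn n) y)) ∈ Q := fun t ht =>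
    Finset.mem_image.2 ⟨(y, t), by simp [hy]; omega, rfl⟩
  have hiter : ∀ t ≤ B, (step (tableStrategy σ))^[t] (vecInit p (List.ofFn n) y) =
      (step s)^[t] (vecInit p (List.ofFn n) y) := by
    intro t
    induction t with
    | zero => exact fun _ => rfl
    | succ t ih =>
      intro ht
      rw [Function.iterate_succ_apply', Function.iterate_succ_apply', ih (by omega)]
      simp only [hstep, simStep]
      rw [hσ _ (hmemQ t (by omega))]
  rw [hiter B le_rfl, hσ _ (hmemQ B le_rfl)]
  obtain ⟨x, rfl, hx⟩ := exists_ofFn_of_mem_vecBox n hy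
  obtain ⟨k, hk, hrun⟩ := hs x hx
  rw [hmap] at hrun
  have := hrun.iterate B hk
  rwa [eqPattern_iterate_model hker hp s hx] at this

/-! ### Computability -/

theorem primrec_pow : Primrec₂ ((· ^ ·) : ℕ → ℕ → ℕ) :=
  Primrec₂.unpaired'.1 Nat.Primrec.pow

theorem primrec_log_two : Primrec (Nat.log 2) := by
  have h : Primrec fun n : ℕ => Nat.findGreatest (fun k => 2 ^ k ≤ n) n :=
    Primrec.nat_findGreatest Primrec.id
      (Primrec.nat_le.comp (primrec_pow.comp (Primrec.const 2) Primrec.snd) Primrec.fst)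
  refine h.of_eq fun n => ?_
  rcases Nat.eq_zero_or_pos n with rfl | hn
  · simp
  rw [Nat.findGreatest_eq_iff]
  refine ⟨Nat.log_le_self 2 n, fun _ => Nat.pow_log_le_self 2 hn.ne', fun k hk _ => ?_⟩
  exact not_le.2 (Nat.lt_pow_of_log_lt (by norm_num) hk)

theorem primrec_list_sum : Primrec (List.sum : List ℕ → ℕ) :=
  Primrec.list_foldr Primrec.id (Primrec.const 0)
    (Primrec.nat_add.comp (Primrec.fst.comp Primrec.snd) (Primrec.snd.comp Primrec.snd)).to₂

variable {A : Type*} [Primcodable A]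

theorem primrec_branchLog : Primrec branchLog :=
  Primrec.succ.comp (Primrec.nat_div.comp (primrec_log_two.comp primrec_log_two) (Primrec.const 3))

theorem primrec_expCost : Primrec₂ expCost := by
  have hl : Primrec fun t : ℕ × ℕ => Nat.log 2 t.2 := primrec_log_two.comp Primrec.snd
  have hb : Primrec fun t : ℕ × ℕ => branchLog t.2 := primrec_branchLog.comp Primrec.snd
  have hp : Primrec fun t : ℕ × ℕ => Nat.log 2 t.1 + 1 :=
    Primrec.succ.comp (primrec_log_two.comp Primrec.fst)
  exact Primrec.nat_mul.comp
    (Primrec.nat_mul.comp (Primrec.const 15) (Primrec.nat_mul.comp Primrec.snd hp))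
    (Primrec.succ.comp (Primrec.nat_add.comp (Primrec.nat_div.comp hl hb)
      (primrec_pow.comp (Primrec.const 4) hb)))

theorem primrec_stepCost : Primrec₂ stepCost := by
  have h1 : Primrec fun t : ℕ × ℕ => t.1 ^ (t.2 / 2) :=
    primrec_pow.comp Primrec.fst (Primrec.nat_div.comp Primrec.snd (Primrec.const 2))
  have h2 : Primrec fun t : ℕ × ℕ => (Nat.sqrt t.1 + 1) ^ (t.2 % 2) :=
    primrec_pow.comp (Primrec.succ.comp (Primrec.nat_sqrt.comp Primrec.fst))
      (Primrec.nat_mod.comp Primrec.snd (Primrec.const 2))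
  exact Primrec.nat_add.comp (Primrec.nat_add.comp
    (Primrec.nat_mul.comp (Primrec.const 2) (Primrec.nat_mul.comp h1 h2))
    (Primrec.nat_mul.comp (Primrec.const 2) Primrec.snd)) (Primrec.const 2)

/-- The total cost as a function of the integer input. -/
def inputCost (input : ℕ × List ℕ) : ℕ :=
  (input.2.map (expCost input.1)).sum + 2 * (Nat.log 2 input.1 + 1) * input.2.foldr max 0 +
    ((List.range (input.2.foldr max 0)).map fun j =>
      stepCost input.1 (input.2.map fun k => if j < k then 1 else 0).sum).sum

/-- The largest n i replaces m, which is not part of the input. -/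
theorem inputCost_ofFn {r : ℕ} (p : ℕ) (n : Fin r → ℕ) :
    inputCost (p, List.ofFn n) = totalCost p ((List.ofFn n).foldr max 0) n := by
  simp only [inputCost, totalCost, List.map_ofFn, List.sum_ofFn, Function.comp_def]
  congr 1
  rw [Finset.sum_range, ← List.sum_ofFn]
  congr 1
  refine List.ext_getElem (by simp) fun i hi hi' => ?_
  simp only [List.getElem_map, List.getElem_range, List.getElem_ofFn]
  rw [Finset.card_filter]

theorem primrec_maxList : Primrec fun l : List ℕ => l.foldr max 0 :=
  Primrec.list_foldr Primrec.id (Primrec.const 0)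
    (Primrec.nat_max.comp (Primrec.fst.comp Primrec.snd) (Primrec.snd.comp Primrec.snd)).to₂

theorem primrec_inputCost : Primrec inputCost := by
  have hmax : Primrec fun t : ℕ × List ℕ => t.2.foldr max 0 :=
    primrec_maxList.comp Primrec.snd
  have h1 : Primrec fun t : ℕ × List ℕ => (t.2.map (expCost t.1)).sum :=
    primrec_list_sum.comp (Primrec.list_map Primrec.snd
      (primrec_expCost.comp (Primrec.fst.comp Primrec.fst) Primrec.snd).to₂)
  have h2 : Primrec fun t : (ℕ × List ℕ) × ℕ => (t.1.2.map fun k => if t.2 < k then 1 else 0).sum :=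
    primrec_list_sum.comp (Primrec.list_map (Primrec.snd.comp Primrec.fst)
      (Primrec.ite (Primrec.nat_lt.comp (Primrec.snd.comp Primrec.fst) Primrec.snd)
        (Primrec.const 1) (Primrec.const 0)).to₂)
  have h3 : Primrec fun t : ℕ × List ℕ => ((List.range (t.2.foldr max 0)).map fun j =>
      stepCost t.1 (t.2.map fun k => if j < k then 1 else 0).sum).sum :=
    primrec_list_sum.comp (Primrec.list_map (Primrec.list_range.comp hmax)
      (primrec_stepCost.comp (Primrec.fst.comp Primrec.fst) h2).to₂)
  exact Primrec.nat_add.comp (Primrec.nat_add.comp h1 (Primrec.nat_mul.comp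
    (Primrec.nat_mul.comp (Primrec.const 2)
      (Primrec.succ.comp (primrec_log_two.comp Primrec.fst))) hmax)) h3

theorem primrec_eqPattern {M : Type*} [DecidableEq M] [Primcodable M] :
    Primrec (eqPattern : List M → List ℕ) :=
  Primrec.list_map Primrec.id (Primrec.list_idxOf.comp Primrec.snd Primrec.fst).to₂

theorem primrec_equivSum : Primrec Instr.equivSum := Primrec.of_equiv

theorem primrec_equivSum_symm : Primrec Instr.equivSum.symm := Primrec.of_equiv_symm

theorem primrec_tableStrategy : Primrec₂ tableStrategy :=
  (Primrec.option_getD.comp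
    (Primrec.list_getElem?.comp Primrec.fst (Primrec.encode.comp Primrec.snd))
    (Primrec.const (Instr.halt []))).to₂

theorem primrec_execWith {M : Type*} [Primcodable M] {mul : A → M → M → M} {inv : A → M → M}
    (hmul : Primrec fun t : A × M × M => mul t.1 t.2.1 t.2.2) (hinv : Primrec₂ inv)
    {L : A → List M} (hL : Primrec L) {i : A → Instr} (hi : Primrec i) :
    Primrec fun a => (i a).execWith (mul a) (inv a) (L a) := by
  have h1 : Primrec₂ fun (a : A) (t : ℕ × ℕ) =>
      ((L a)[t.1]?.bind fun g => (L a)[t.2]?.map fun h => mul a g h) := by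
    have hLa : Primrec fun t : A × ℕ × ℕ => L t.1 := hL.comp Primrec.fst
    refine Primrec.option_bind
      (Primrec.list_getElem?.comp hLa (Primrec.fst.comp Primrec.snd)) ?_
    refine Primrec.option_map (Primrec.list_getElem?.comp (hLa.comp Primrec.fst)
      (Primrec.snd.comp (Primrec.snd.comp Primrec.fst))) ?_
    exact hmul.comp (Primrec.pair (Primrec.fst.comp (Primrec.fst.comp Primrec.fst))
      (Primrec.pair (Primrec.snd.comp Primrec.fst) Primrec.snd))
  have h3 : Primrec₂ fun (a : A) (t : ℕ) => (L a)[t]?.map (inv a) :=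
    Primrec.option_map (Primrec.list_getElem?.comp (hL.comp Primrec.fst) Primrec.snd)
      (hinv.comp (Primrec.fst.comp Primrec.fst) Primrec.snd).to₂
  have h2 : Primrec₂ fun (a : A) (t : ℕ ⊕ List ℕ) =>
      (Sum.casesOn t (fun k => (L a)[k]?.map (inv a)) fun _ => none : Option M) :=
    Primrec.sumCasesOn Primrec.snd
      (h3.comp (Primrec.fst.comp Primrec.fst) Primrec.snd).to₂ (Primrec.const none).to₂
  refine (Primrec.sumCasesOn (primrec_equivSum.comp hi) h1 h2).of_eq fun a => ?_
  cases i a <;> rfl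

theorem primrec_simStep {M : Type*} [DecidableEq M] [Primcodable M] {mul : A → M → M → M}
    {inv : A → M → M} {s : A → List ℕ → Instr}
    (hmul : Primrec fun t : A × M × M => mul t.1 t.2.1 t.2.2) (hinv : Primrec₂ inv)
    (hs : Primrec₂ s) : Primrec₂ fun a L => simStep (mul a) (inv a) (s a) L := by
  refine Primrec.list_append.comp Primrec.snd (Primrec.optionToList.comp ?_)
  refine primrec_execWith (mul := fun t : A × List M => mul t.1) (inv := fun t => inv t.1) ?_ ?_
    Primrec.snd ?_
  · exact hmul.comp (Primrec.pair (Primrec.fst.comp Primrec.fst) Primrec.snd)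
  · exact hinv.comp (Primrec.fst.comp Primrec.fst) Primrec.snd
  · exact hs.comp Primrec.fst (primrec_eqPattern.comp Primrec.snd)

theorem primrec_vecAdd :
    Primrec fun t : (ℕ × List ℕ) × List ℕ × List ℕ => vecAdd t.1.1 t.1.2 t.2.1 t.2.2 := by
  have hn : Primrec fun t : (ℕ × List ℕ) × List ℕ × List ℕ => t.1.2 :=
    Primrec.snd.comp Primrec.fst
  refine Primrec.list_map (Primrec.list_range.comp (Primrec.list_length.comp hn)) ?_
  refine Primrec.nat_mod.comp (Primrec.nat_add.comp
    ((Primrec.list_getD 0).comp (Primrec.fst.comp (Primrec.snd.comp Primrec.fst)) Primrec.snd)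
    ((Primrec.list_getD 0).comp (Primrec.snd.comp (Primrec.snd.comp Primrec.fst)) Primrec.snd)) ?_
  exact primrec_pow.comp (Primrec.fst.comp (Primrec.fst.comp Primrec.fst))
    ((Primrec.list_getD 0).comp (hn.comp Primrec.fst) Primrec.snd)

theorem primrec_vecNeg : Primrec₂ fun (t : ℕ × List ℕ) (a : List ℕ) => vecNeg t.1 t.2 a := by
  have hn : Primrec fun t : (ℕ × List ℕ) × List ℕ => t.1.2 := Primrec.snd.comp Primrec.fst
  refine Primrec.list_map (Primrec.list_range.comp (Primrec.list_length.comp hn)) ?_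
  have hq : Primrec fun t : ((ℕ × List ℕ) × List ℕ) × ℕ => t.1.1.1 ^ t.1.1.2.getD t.2 0 :=
    primrec_pow.comp (Primrec.fst.comp (Primrec.fst.comp Primrec.fst))
      ((Primrec.list_getD 0).comp (hn.comp Primrec.fst) Primrec.snd)
  exact Primrec.nat_mod.comp (Primrec.nat_sub.comp hq
    ((Primrec.list_getD 0).comp (Primrec.snd.comp Primrec.fst) Primrec.snd)) hq

theorem primrec_vecUnit : Primrec₂ fun (t : ℕ × List ℕ) (k : ℕ) => vecUnit t.1 t.2 k := by
  have hn : Primrec fun t : (ℕ × List ℕ) × ℕ => t.1.2 := Primrec.snd.comp Primrec.fst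
  refine Primrec.list_map (Primrec.list_range.comp (Primrec.list_length.comp hn)) ?_
  have hq : Primrec fun t : ((ℕ × List ℕ) × ℕ) × ℕ => t.1.1.1 ^ t.1.1.2.getD t.2 0 :=
    primrec_pow.comp (Primrec.fst.comp (Primrec.fst.comp Primrec.fst))
      ((Primrec.list_getD 0).comp (hn.comp Primrec.fst) Primrec.snd)
  exact Primrec.nat_mod.comp (Primrec.ite
    (Primrec.eq.comp Primrec.snd (Primrec.snd.comp Primrec.fst))
    (Primrec.const 1) (Primrec.const 0)) hq

theorem primrec_vecInit :
    Primrec₂ fun (t : ℕ × List ℕ) (y : List ℕ) => vecInit t.1 t.2 y := by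
  have hn : Primrec fun t : (ℕ × List ℕ) × List ℕ => t.1.2.length :=
    Primrec.list_length.comp (Primrec.snd.comp Primrec.fst)
  refine Primrec.list_append.comp (Primrec.list_append.comp
    (Primrec.list_cons.comp (primrec_vecUnit.comp Primrec.fst hn)
      (Primrec.const ([] : List (List ℕ))))
    (Primrec.list_map (Primrec.list_range.comp hn)
      (primrec_vecUnit.comp (Primrec.fst.comp Primrec.fst) Primrec.snd).to₂)) ?_
  exact Primrec.list_cons.comp Primrec.snd (Primrec.const ([] : List (List ℕ)))

theorem primrec_vecBox : Primrec fun t : ℕ × List ℕ => vecBox t.1 t.2 := by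
  have h : Primrec₂ fun (t : ℕ × List ℕ) (q : ℕ × List (List ℕ)) =>
      (List.range (t.1 ^ q.1)).flatMap fun a => q.2.map (a :: ·) := by
    refine Primrec.list_flatMap (Primrec.list_range.comp
      (primrec_pow.comp (Primrec.fst.comp Primrec.fst) (Primrec.fst.comp Primrec.snd))) ?_
    exact Primrec.list_map (Primrec.snd.comp (Primrec.snd.comp Primrec.fst))
      (Primrec.list_cons.comp (Primrec.snd.comp Primrec.fst) Primrec.snd).to₂
  exact Primrec.list_foldr (f := fun t : ℕ × List ℕ => t.2) Primrec.snd
    (Primrec.const ([[]] : List (List ℕ))) h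

/-- The result of the simulation of a table in the model. -/
def simResult (t : ((ℕ × List ℕ) × List Instr) × List ℕ) : Instr :=
  tableStrategy t.1.2 (eqPattern
    ((simStep (vecAdd t.1.1.1 t.1.1.2) (vecNeg t.1.1.1 t.1.1.2) (tableStrategy t.1.2))^[
      inputCost t.1.1] (vecInit t.1.1.1 t.1.1.2 t.2)))

theorem primrec_simResult : Primrec simResult := by
  have hin : Primrec fun t : ((ℕ × List ℕ) × List Instr) × List ℕ => t.1.1 :=
    Primrec.fst.comp Primrec.fst
  have hσ : Primrec fun t : ((ℕ × List ℕ) × List Instr) × List ℕ => t.1.2 :=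
    Primrec.snd.comp Primrec.fst
  have hstep := primrec_simStep
    (mul := fun t : ((ℕ × List ℕ) × List Instr) × List ℕ => vecAdd t.1.1.1 t.1.1.2)
    (inv := fun t => vecNeg t.1.1.1 t.1.1.2) (s := fun t => tableStrategy t.1.2)
    (primrec_vecAdd.comp (Primrec.pair (hin.comp Primrec.fst) Primrec.snd))
    (primrec_vecNeg.comp (hin.comp Primrec.fst) Primrec.snd)
    (primrec_tableStrategy.comp (hσ.comp Primrec.fst) Primrec.snd)
  exact primrec_tableStrategy.comp hσ (primrec_eqPattern.comp (Primrec.nat_iterate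
    (primrec_inputCost.comp hin) (primrec_vecInit.comp hin Primrec.snd) hstep))

/-- The table solves all instances with the given integer input. -/
def Solves (input : ℕ × List ℕ) (σ : List Instr) : Prop :=
  input.1 = 0 ∨ ∀ y ∈ vecBox input.1 input.2, simResult ((input, σ), y) = .halt y

theorem primrec_halt : Primrec Instr.halt :=
  (primrec_equivSum_symm.comp (Primrec.sumInr.comp Primrec.sumInr)).of_eq fun _ => rfl

/-- The check is bounded: finitely many vectors, each simulated for a primitive recursive number of
steps. -/
theorem primrecRel_solves : PrimrecRel Solves := by
  have h0 : PrimrecPred fun t : (ℕ × List ℕ) × List Instr => t.1.1 = 0 :=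
    Primrec.eq.comp (Primrec.fst.comp Primrec.fst) (Primrec.const 0)
  have hR : PrimrecRel fun (y : List ℕ) (t : (ℕ × List ℕ) × List Instr) =>
      simResult (t, y) = .halt y := by
    classical
    exact Primrec.eq.comp (primrec_simResult.comp (Primrec.pair Primrec.snd Primrec.fst))
      (primrec_halt.comp Primrec.fst)
  exact h0.or (hR.forall_mem_list.comp (primrec_vecBox.comp Primrec.fst) Primrec.id)

theorem le_foldr_max {k : ℕ} {l : List ℕ} (h : k ∈ l) : k ≤ l.foldr max 0 := by
  induction l with
  | nil => simp at h
  | cons a l ih =>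
    rcases List.mem_cons.1 h with rfl | h
    · exact le_max_left _ _
    · exact (ih h).trans (le_max_right _ _)

/-- The search must end on every input, including the meaningless p = 0, which `Solves` accepts for
that reason. -/
theorem exists_solves (input : ℕ × List ℕ) : ∃ σ, Solves input σ := by
  obtain ⟨p, l⟩ := input
  rcases Nat.eq_zero_or_pos p with rfl | hp
  · exact ⟨[], Or.inl rfl⟩
  · rw [← List.ofFn_get l]
    obtain ⟨σ, hσ⟩ := exists_table hp l.get ((List.ofFn l.get).foldr max 0) fun i =>
      le_foldr_max ((List.mem_ofFn' _ _).2 ⟨i, rfl⟩)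
    refine ⟨σ, Or.inr fun y hy => ?_⟩
    rw [simResult, inputCost_ofFn]
    exact hσ y hy

theorem exists_table_code (input : ℕ × List ℕ) :
    ∃ k, Solves input ((Encodable.decode k : Option (List Instr)).getD []) := by
  obtain ⟨σ, hσ⟩ := exists_solves input
  exact ⟨Encodable.encode σ, by simpa using hσ⟩

open Classical in
/-- The first table that solves all instances with the given integer input. -/
noncomputable def findTable (input : ℕ × List ℕ) : List Instr :=
  (Encodable.decode (Nat.find (exists_table_code input)) : Option (List Instr)).getD []

theorem solves_findTable (input : ℕ × List ℕ) : Solves input (findTable input) := by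
  classical
  exact Nat.find_spec (exists_table_code input)

theorem computable_findTable : Computable findTable := by
  classical
  have h : PrimrecRel fun (input : ℕ × List ℕ) (k : ℕ) =>
      Solves input ((Encodable.decode k : Option (List Instr)).getD []) :=
    primrecRel_solves.comp Primrec.fst
      (Primrec.option_getD.comp (Primrec.decode.comp Primrec.snd) (Primrec.const []))
  exact Primrec.option_getD.to_comp.comp (Computable.decode.comp
    (Computable.find h.computablePred exists_table_code)) (Computable.const [])

/-- Search for a table that solves all instances in the model, and follow it. -/
noncomputable def tableAlgorithm : GenericAlgorithm where
  next t := tableStrategy (findTable t.1) (eqPattern t.2)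
  computable_next := primrec_tableStrategy.to_comp.comp (computable_findTable.comp Computable.fst)
    (primrec_eqPattern.to_comp.comp Computable.snd)

/-! ### Bases of abelian `p`-groups -/

section Basis

variable {G : Type*} [CommGroup G] {r p : ℕ} {n : Fin r → ℕ} {α : Fin r → G}

/-- Reduced exponent vectors are discrete logarithms, hence unique. Independence of α enters the
analysis of the algorithm in this form. -/
theorem IsBasis.prod_pow_eq_iff (hα : IsBasis α) (hp : 0 < p) (hn : ∀ i, orderOf (α i) = p ^ n i)
    (a b : Fin r → ℕ) : ∏ i, α i ^ a i = ∏ i, α i ^ b i ↔ ∀ i, a i ≡ b i [MOD p ^ n i] := by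
  have hred : ∀ a : Fin r → ℕ, IsDL α (∏ i, α i ^ a i) fun i => a i % p ^ n i := fun a =>
    ⟨fun i => by rw [hn]; exact Nat.mod_lt _ (by positivity),
      Finset.prod_congr rfl fun i _ => by simp only [← hn, pow_mod_orderOf]⟩
  constructor
  · intro h i
    have h1 := hred b
    rw [← h] at h1
    exact congrFun ((hα.2 _).unique (hred a) h1) i
  · intro h
    refine Finset.prod_congr rfl fun i _ => ?_
    rw [pow_eq_pow_iff_modEq, hn]
    exact h i

/-- Reading the exponents x i of ∏ α i ^ (p^j * x i) modulo p, for n i > j, gives a homomorphism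
onto F_p^R. The image of a minimal generating set spans this space. -/
theorem card_le_rank_powSubgroup [Finite G] (hp : p.Prime)
    (hker : ∀ a b : Fin r → ℕ, ∏ i, α i ^ a i = ∏ i, α i ^ b i ↔ ∀ i, a i ≡ b i [MOD p ^ n i])
    (hsurj : ∀ g : G, ∃ x : Fin r → ℕ, ∏ i, α i ^ x i = g) (j : ℕ) :
    (Finset.univ.filter fun i => j < n i).card ≤ Group.rank (powSubgroup G (p ^ j)) := by
  classical
  have : Fact p.Prime := ⟨hp⟩
  set R := Finset.univ.filter fun i => j < n i with hR
  have hpow : ∀ x : Fin r → ℕ, (∏ i, α i ^ x i) ^ p ^ j = ∏ i, α i ^ (p ^ j * x i) := fun x => by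
    rw [← Finset.prod_pow]
    exact Finset.prod_congr rfl fun i _ => by rw [mul_comm, pow_mul]
  have hmemK : ∀ x : Fin r → ℕ, ∏ i, α i ^ (p ^ j * x i) ∈ powSubgroup G (p ^ j) := fun x =>
    ⟨∏ i, α i ^ x i, hpow x⟩
  have hex : ∀ g : powSubgroup G (p ^ j), ∃ x : Fin r → ℕ, ∏ i, α i ^ (p ^ j * x i) = g := by
    rintro ⟨-, g, rfl⟩
    obtain ⟨x, rfl⟩ := hsurj g
    exact ⟨x, (hpow x).symm⟩
  choose c hc using hex
  have huniq : ∀ x y : Fin r → ℕ, ∏ i, α i ^ (p ^ j * x i) = ∏ i, α i ^ (p ^ j * y i) →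
      ∀ i ∈ R, (x i : ZMod p) = y i := by
    intro x y h i hi
    have hij : j < n i := (Finset.mem_filter.1 hi).2
    have h1 := (hker _ _).1 h i
    have e : p ^ n i = p ^ j * p ^ (n i - j) := by rw [← pow_add]; congr 1; omega
    rw [e] at h1
    have h2 := Nat.ModEq.mul_left_cancel' (pow_pos hp.pos j).ne' h1
    exact (ZMod.natCast_eq_natCast_iff _ _ _).2 (h2.of_dvd (dvd_pow_self p (by omega)))
  set ψ : powSubgroup G (p ^ j) → (R → ZMod p) := fun g i => c g i with hψ
  have hmul : ∀ g h, ψ (g * h) = ψ g + ψ h := by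
    intro g h
    funext i
    have := huniq (c (g * h)) (fun i => c g i + c h i) (by
      rw [hc, Subgroup.coe_mul, ← hc g, ← hc h, ← Finset.prod_mul_distrib]
      exact Finset.prod_congr rfl fun i _ => by rw [mul_add, pow_add]) i i.2
    simpa [hψ] using this
  have hone : ψ 1 = 0 := by
    have := hmul 1 1
    rw [mul_one] at this
    exact left_eq_add.1 this
  have hsurjψ : Function.Surjective ψ := by
    intro v
    set x : Fin r → ℕ := fun i => if h : i ∈ R then (v ⟨i, h⟩).val else 0 with hx
    refine ⟨⟨∏ i, α i ^ (p ^ j * x i), hmemK x⟩, ?_⟩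
    funext i
    simp only [hψ]
    rw [huniq _ x (hc ⟨_, hmemK x⟩) i i.2]
    simp [hx]
  obtain ⟨S, hS, hclos⟩ := Group.rank_spec (powSubgroup G (p ^ j))
  have hspan : Submodule.span (ZMod p) ((S.image ψ : Finset _) : Set (R → ZMod p)) = ⊤ := by
    rw [eq_top_iff]
    rintro v -
    obtain ⟨g, rfl⟩ := hsurjψ v
    have hg : g ∈ Subgroup.closure (S : Set (powSubgroup G (p ^ j))) := by
      rw [hclos]; trivial
    induction hg using Subgroup.closure_induction with
    | mem g hg => exact Submodule.subset_span (by
        rw [Finset.coe_image]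
        exact ⟨g, hg, rfl⟩)
    | one => rw [hone]; exact Submodule.zero_mem _
    | mul g h _ _ ihg ihh => rw [hmul]; exact Submodule.add_mem _ ihg ihh
    | inv g _ ih =>
      have : ψ g⁻¹ = - ψ g := by
        rw [eq_neg_iff_add_eq_zero, ← hmul, inv_mul_cancel, hone]
      rw [this]
      exact Submodule.neg_mem _ ih
  have h1 := finrank_span_finset_le_card (R := ZMod p) (S.image ψ)
  rw [Set.finrank, hspan, finrank_top, Module.finrank_fintype_fun_eq_card, Fintype.card_coe] at h1
  rw [← hS]
  exact h1.trans Finset.card_image_le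

end Basis

/-! ### The cost in terms of logarithms -/

/-- The division by 3 in `branchLog` gives 8^u ≤ max (lg k) 1, so (u + 1) · 4^(u+1) ≤ 4 · 2^u · 4^u
is still O(lg k). The constant is 9 = 1 + 4 + 4. -/
theorem branchLog_mul_le (k : ℕ) :
    branchLog k * (Nat.log 2 k / branchLog k + 4 ^ branchLog k + 1) ≤ 9 * max (Nat.log 2 k) 1 := by
  set l := Nat.log 2 k
  set u := Nat.log 2 l / 3 with hu
  have ht : branchLog k = u + 1 := rfl
  rw [ht]
  set M := max l 1 with hM
  have h1 : (u + 1) * (l / (u + 1)) ≤ M := (Nat.mul_div_le _ _).trans (le_max_left _ _)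
  have h2 : 8 ^ u ≤ M := by
    rcases Nat.eq_zero_or_pos l with h | h
    · have : u = 0 := by rw [hu, h]; simp
      rw [this]; exact le_max_right _ _
    · calc 8 ^ u = 2 ^ (3 * u) := by rw [pow_mul]; norm_num
        _ ≤ 2 ^ Nat.log 2 l := Nat.pow_le_pow_right (by norm_num) (Nat.mul_div_le _ _)
        _ ≤ l := Nat.pow_log_le_self 2 h.ne'
        _ ≤ M := le_max_left _ _
  have h3 : (u + 1) * 4 ^ (u + 1) ≤ 4 * M := by
    have : u + 1 ≤ 2 ^ u := Nat.lt_two_pow_self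
    calc (u + 1) * 4 ^ (u + 1) ≤ 2 ^ u * 4 ^ (u + 1) := by gcongr
      _ = 4 * (2 ^ u * 4 ^ u) := by ring
      _ = 4 * 8 ^ u := by rw [← mul_pow]; norm_num
      _ ≤ 4 * M := by gcongr
  have h4 : u + 1 ≤ (u + 1) * 4 ^ (u + 1) := Nat.le_mul_of_pos_right _ (by positivity)
  calc _ = (u + 1) * (l / (u + 1)) + (u + 1) * 4 ^ (u + 1) + (u + 1) := by ring
    _ ≤ _ := by omega

theorem le_lg_of_two_pow_le {k m : ℕ} (h : 2 ^ m ≤ k) : (m : ℝ) ≤ lg k := by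
  have h0 : (0 : ℝ) < 2 ^ m := by positivity
  have h1 : (2 : ℝ) ^ m ≤ k := by exact_mod_cast h
  rw [lg, Real.le_logb_iff_rpow_le (by norm_num) (h0.trans_le h1), Real.rpow_natCast]
  exact h1

theorem lg_le_of_le_two_pow {x : ℝ} {m : ℕ} (h0 : 0 < x) (h : x ≤ 2 ^ m) : lg x ≤ m := by
  rw [lg, Real.logb_le_iff_le_rpow (by norm_num) h0, Real.rpow_natCast]
  exact h

theorem branchCost_le {k : ℕ} (hk : 0 < k) :
    ((Nat.log 2 k / branchLog k + 4 ^ branchLog k + 1 : ℕ) : ℝ) ≤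
      36 * (lg ((k : ℝ) + 1) / lg (lg ((k : ℝ) + 2))) := by
  have h1 := branchLog_mul_le k
  set f := Nat.log 2 k / branchLog k + 4 ^ branchLog k + 1
  set t := branchLog k with ht
  set M := max (Nat.log 2 k) 1 with hM
  have ht0 : (0 : ℝ) < t := by exact_mod_cast Nat.succ_pos _
  have hnum : (M : ℝ) ≤ lg ((k : ℝ) + 1) := by
    have : 2 ^ M ≤ k + 1 := by
      rcases le_total (Nat.log 2 k) 1 with h | h
      · rw [hM, max_eq_right h]; omega
      · rw [hM, max_eq_left h]
        exact (Nat.pow_log_le_self 2 hk.ne').trans (Nat.le_succ k)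
    exact_mod_cast le_lg_of_two_pow_le this
  have hk2 : (2 : ℝ) < (k : ℝ) + 2 := by
    have : (0 : ℝ) < k := by exact_mod_cast hk
    linarith
  have hlg1 : 1 < lg ((k : ℝ) + 2) := by
    rw [lg, Real.lt_logb_iff_rpow_lt (by norm_num) (by linarith), Real.rpow_one]
    exact hk2
  have hpos : 0 < lg (lg ((k : ℝ) + 2)) := Real.logb_pos (by norm_num) hlg1
  have hlg2 : lg ((k : ℝ) + 2) ≤ ((Nat.log 2 k + 2 : ℕ) : ℝ) := by
    refine lg_le_of_le_two_pow (by linarith) ?_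
    have h := Nat.lt_pow_succ_log_self (by norm_num : 1 < 2) k
    have : k + 2 ≤ 2 ^ (Nat.log 2 k + 2) := by
      rw [Nat.succ_eq_add_one, pow_succ] at h
      rw [pow_add]
      have : 1 ≤ 2 ^ Nat.log 2 k := Nat.one_le_two_pow
      omega
    exact_mod_cast this
  have hden : lg (lg ((k : ℝ) + 2)) ≤ 4 * t := by
    have h2 : lg (lg ((k : ℝ) + 2)) ≤ ((Nat.log 2 (Nat.log 2 k) + 2 : ℕ) : ℝ) := by
      refine lg_le_of_le_two_pow (by linarith) (hlg2.trans ?_)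
      have h := Nat.lt_pow_succ_log_self (by norm_num : 1 < 2) (Nat.log 2 k)
      have : Nat.log 2 k + 2 ≤ 2 ^ (Nat.log 2 (Nat.log 2 k) + 2) := by
        rw [Nat.succ_eq_add_one, pow_succ] at h
        rw [pow_add]
        have : 1 ≤ 2 ^ Nat.log 2 (Nat.log 2 k) := Nat.one_le_two_pow
        omega
      exact_mod_cast this
    refine h2.trans ?_
    have : Nat.log 2 (Nat.log 2 k) + 2 ≤ 4 * t := by
      rw [ht, branchLog]; omega
    exact_mod_cast this
  have h2 : (t : ℝ) * f ≤ 9 * M := by exact_mod_cast h1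
  have h3 : (M : ℝ) / (4 * t) ≤ lg ((k : ℝ) + 1) / lg (lg ((k : ℝ) + 2)) :=
    div_le_div₀ ((Nat.cast_nonneg M).trans hnum) hnum hpos hden
  -- 36 = 9 · 4, with 9 from `branchLog_mul_le` and 4 from `hden`.
  calc (f : ℝ) ≤ 36 * ((M : ℝ) / (4 * t)) := by
        rw [← mul_div_assoc, le_div_iff₀ (by positivity)]
        linarith
    _ ≤ _ := by gcongr

theorem expCost_le {p : ℕ} (hp : 2 ≤ p) (k : ℕ) :
    (expCost p k : ℝ) ≤
      1080 * (lg ((k : ℝ) + 1) / lg (lg ((k : ℝ) + 2)) * lg ((p ^ k : ℕ) : ℝ)) := by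
  rcases Nat.eq_zero_or_pos k with rfl | hk
  · simp [expCost, lg]
  have h1 := branchCost_le hk
  set X := lg ((k : ℝ) + 1) / lg (lg ((k : ℝ) + 2))
  set f := Nat.log 2 k / branchLog k + 4 ^ branchLog k + 1 with hf
  have hlg : lg ((p ^ k : ℕ) : ℝ) = k * lg p := by
    rw [lg, Nat.cast_pow, Real.logb_pow, lg]
  have h2 : ((Nat.log 2 p + 1 : ℕ) : ℝ) ≤ 2 * lg p := by
    have h3 := le_lg_of_two_pow_le (Nat.pow_log_le_self 2 (by omega : p ≠ 0))
    have h4 := le_lg_of_two_pow_le (m := 1) (by simpa using hp)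
    push_cast at *
    linarith
  rw [expCost, ← hf, hlg]
  calc ((15 * (k * (Nat.log 2 p + 1)) * f : ℕ) : ℝ)
      = 15 * (k * ((Nat.log 2 p + 1 : ℕ) : ℝ)) * (f : ℝ) := by push_cast; ring
    _ ≤ 15 * (k * (2 * lg p)) * (36 * X) := by
        have : 0 ≤ lg p := by
          have : (0 : ℝ) ≤ ((Nat.log 2 p + 1 : ℕ) : ℝ) := Nat.cast_nonneg _
          linarith
        gcongr
    _ = _ := by ring

/-- 8 = 2 · 2 + 4: ⌊√p⌋ + 1 ≤ 2√p bounds the two boxes, and 2ρ + 2 ≤ 4 p^(ρ/2) the rest. -/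
theorem stepCost_le {p : ℕ} (hp : 2 ≤ p) (ρ : ℕ) :
    (stepCost p ρ : ℝ) ≤ 8 * (p : ℝ) ^ ((ρ : ℝ) / 2) := by
  have hp1 : (1 : ℝ) ≤ p := by exact_mod_cast (by omega : 1 ≤ p)
  have h1 : ((p ^ (ρ / 2) : ℕ) : ℝ) ≤ (p : ℝ) ^ ((ρ : ℝ) / 2) := by
    rw [Nat.cast_pow, ← Real.rpow_natCast]
    refine Real.rpow_le_rpow_of_exponent_le hp1 ?_
    exact_mod_cast Nat.cast_div_le (α := ℝ) (m := ρ) (n := 2)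
  have h2 : ((2 * ρ + 2 : ℕ) : ℝ) ≤ 4 * (p : ℝ) ^ ((ρ : ℝ) / 2) := by
    have h3 := succ_le_two_mul_two_pow_half ρ
    have h4 : 2 ^ (ρ / 2) ≤ p ^ (ρ / 2) := Nat.pow_le_pow_left hp _
    have h5 : 2 * ρ + 2 ≤ 4 * p ^ (ρ / 2) := by omega
    calc ((2 * ρ + 2 : ℕ) : ℝ) ≤ ((4 * p ^ (ρ / 2) : ℕ) : ℝ) := by exact_mod_cast h5
      _ = 4 * ((p ^ (ρ / 2) : ℕ) : ℝ) := by push_cast; ring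
      _ ≤ _ := by gcongr
  have h3 : ((p ^ (ρ / 2) * (Nat.sqrt p + 1) ^ (ρ % 2) : ℕ) : ℝ) ≤
      2 * (p : ℝ) ^ ((ρ : ℝ) / 2) := by
    rcases Nat.mod_two_eq_zero_or_one ρ with h | h
    · rw [h, pow_zero, mul_one]
      have : (0 : ℝ) ≤ (p : ℝ) ^ ((ρ : ℝ) / 2) := by positivity
      linarith
    · have hs : (((Nat.sqrt p + 1 : ℕ)) : ℝ) ≤ 2 * (p : ℝ) ^ (1 / 2 : ℝ) := by
        rw [← Real.sqrt_eq_rpow]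
        have h4 := Real.nat_sqrt_le_real_sqrt (a := p)
        have h5 : 1 ≤ Real.sqrt p := Real.one_le_sqrt.2 hp1
        push_cast
        linarith
      have e : (p : ℝ) ^ ((ρ : ℝ) / 2) = (p : ℝ) ^ (ρ / 2) * (p : ℝ) ^ (1 / 2 : ℝ) := by
        rw [← Real.rpow_natCast, ← Real.rpow_add (by linarith)]
        congr 1
        have : (ρ : ℝ) = 2 * ((ρ / 2 : ℕ) : ℝ) + 1 := by
          exact_mod_cast (by omega : ρ = 2 * (ρ / 2) + 1)
        linarith
      rw [h, pow_one, Nat.cast_mul, Nat.cast_pow, e]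
      calc (p : ℝ) ^ (ρ / 2) * ((Nat.sqrt p + 1 : ℕ) : ℝ)
          ≤ (p : ℝ) ^ (ρ / 2) * (2 * (p : ℝ) ^ (1 / 2 : ℝ)) := by gcongr
        _ = _ := by ring
  rw [stepCost]
  push_cast at h2 h3 ⊢
  linarith

theorem foldr_max_le {l : List ℕ} {m : ℕ} (h : ∀ k ∈ l, k ≤ m) : l.foldr max 0 ≤ m := by
  induction l with
  | nil => simp
  | cons a l ih =>
    exact max_le (h a List.mem_cons_self) (ih fun k hk => h k (List.mem_cons_of_mem _ hk))

theorem totalCost_le {r p m M : ℕ} (hp : 2 ≤ p) (n : Fin r → ℕ) (hM : M ≤ m) (hMn : M ≤ ∑ i, n i)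
    (R : ℕ → ℕ) (hR : ∀ j, (Finset.univ.filter fun i => j < n i).card ≤ R j) :
    (totalCost p M n : ℝ) ≤ 2160 *
      (∑ i, lg ((n i : ℝ) + 1) / lg (lg ((n i : ℝ) + 2)) * lg ((p ^ n i : ℕ) : ℝ) +
        ∑ j ∈ Finset.range m, (p : ℝ) ^ ((R j : ℝ) / 2)) := by
  have hp1 : (1 : ℝ) ≤ p := by exact_mod_cast (by omega : 1 ≤ p)
  have h1 : ((∑ i, expCost p (n i) : ℕ) : ℝ) ≤
      1080 * ∑ i, lg ((n i : ℝ) + 1) / lg (lg ((n i : ℝ) + 2)) * lg ((p ^ n i : ℕ) : ℝ) := by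
    rw [Nat.cast_sum, Finset.mul_sum]
    exact Finset.sum_le_sum fun i _ => expCost_le hp (n i)
  -- The powers of β cost no more than the chains, which doubles 1080 to 2160.
  have h2 : 2 * (Nat.log 2 p + 1) * M ≤ ∑ i, expCost p (n i) := by
    calc 2 * (Nat.log 2 p + 1) * M ≤ 2 * (Nat.log 2 p + 1) * ∑ i, n i := by gcongr
      _ = ∑ i, 2 * (Nat.log 2 p + 1) * n i := Finset.mul_sum _ _ _
      _ ≤ _ := by
        refine Finset.sum_le_sum fun i _ => ?_
        rw [expCost]
        calc 2 * (Nat.log 2 p + 1) * n i = 2 * (n i * (Nat.log 2 p + 1)) := by ring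
          _ ≤ 15 * (n i * (Nat.log 2 p + 1)) := by gcongr; norm_num
          _ ≤ _ := Nat.le_mul_of_pos_right _ (Nat.succ_pos _)
  have h3 : ((∑ j ∈ Finset.range M, stepCost p (Finset.univ.filter fun i => j < n i).card : ℕ) : ℝ)
      ≤ 8 * ∑ j ∈ Finset.range m, (p : ℝ) ^ ((R j : ℝ) / 2) := by
    rw [Nat.cast_sum, Finset.mul_sum]
    refine (Finset.sum_le_sum fun j _ => ?_).trans
      (Finset.sum_le_sum_of_subset_of_nonneg (Finset.range_subset_range.2 hM) ?_)
    · refine (stepCost_le hp _).trans ?_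
      gcongr
      exact hR j
    · intro j _ _
      positivity
  have h4 : 0 ≤ ∑ j ∈ Finset.range m, (p : ℝ) ^ ((R j : ℝ) / 2) :=
    Finset.sum_nonneg fun j _ => by positivity
  have h5 : ((2 * (Nat.log 2 p + 1) * M : ℕ) : ℝ) ≤ ((∑ i, expCost p (n i) : ℕ) : ℝ) := by
    exact_mod_cast h2
  rw [totalCost, Nat.cast_add, Nat.cast_add]
  linarith

end GenericDL

theorem proposition1 :
    ∃ (c : ℝ) (A : GenericDL.GenericAlgorithm),
      ∀ (G : Type*) [CommGroup G] [Finite G] (p m r : ℕ) (α : Fin r → G) (n : Fin r → ℕ),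
        p.Prime →
        IsPGroup p G →
        Monoid.exponent G = p ^ m →
        Group.rank G = r →
        GenericDL.IsBasis α →
        (∀ i, orderOf (α i) = p ^ n i) →
        ∀ (label : G → ℕ), Function.Injective label →
        ∀ β : G, ∃ (T : ℕ) (x : Fin r → ℕ),
          A.Run label (p, List.ofFn n) ([1] ++ List.ofFn α ++ [β]) T (List.ofFn x) ∧
          GenericDL.IsDL α β x ∧
          (T : ℝ) ≤ c *
            (∑ i, GenericDL.lg ((n i : ℝ) + 1) / GenericDL.lg (GenericDL.lg ((n i : ℝ) + 2))
                * GenericDL.lg (orderOf (α i) : ℝ)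
              + ∑ j ∈ Finset.range m,
                  (p : ℝ) ^ ((Group.rank (GenericDL.powSubgroup G (p ^ j)) : ℝ) / 2)) := by
  classical
  refine ⟨2160, GenericDL.tableAlgorithm, ?_⟩
  intro G _ _ p m r α n hp _ hexp _ hα hn label hlabel β
  have hker := hα.prod_pow_eq_iff hp.pos hn
  obtain ⟨x, hx, -⟩ := hα.2 β
  have hxn : ∀ i, x i < p ^ n i := fun i => hn i ▸ hx.1 i
  have hnm : ∀ k ∈ List.ofFn n, k ≤ m := by
    intro k hk
    obtain ⟨i, rfl⟩ := (List.mem_ofFn' _ _).1 hk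
    rw [← Nat.pow_dvd_pow_iff_le_right hp.one_lt, ← hn i, ← hexp]
    exact Monoid.order_dvd_exponent (α i)
  have hnsum : ∀ k ∈ List.ofFn n, k ≤ ∑ i, n i := by
    intro k hk
    obtain ⟨i, rfl⟩ := (List.mem_ofFn' _ _).1 hk
    exact Finset.single_le_sum (fun _ _ => Nat.zero_le _) (Finset.mem_univ i)
  -- The table is correct in the model. Its patterns there are those in G, and, since labels are
  -- injective, those of the identifiers.
  have hsolve := (GenericDL.solves_findTable (p, List.ofFn n)).resolve_left hp.ne_zero
    (List.ofFn x) ((GenericDL.mem_vecBox_ofFn n x).2 hxn)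
  rw [GenericDL.simResult, GenericDL.inputCost_ofFn,
    ← GenericDL.eqPattern_iterate_model hker hp.pos _ hxn, hx.2] at hsolve
  obtain ⟨T, hT, hrun⟩ := GenericDL.exists_run_of_iterate GenericDL.tableAlgorithm label
    (p, List.ofFn n) _ (fun L => congrArg
      (GenericDL.tableStrategy (GenericDL.findTable (p, List.ofFn n)))
      (GenericDL.eqPattern_map label L fun a _ b _ h => hlabel h)) _ _ _ hsolve
  refine ⟨T, x, hrun, hx, ?_⟩
  have hcost := GenericDL.totalCost_le hp.two_le n (GenericDL.foldr_max_le hnm)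
    (GenericDL.foldr_max_le hnsum) _ (GenericDL.card_le_rank_powSubgroup hp hker
      fun g => (hα.2 g).exists.imp fun _ h => h.2)
  simp_rw [hn]
  exact (Nat.cast_le.2 hT).trans hcost
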